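/- Let $k$ be a unital commutative ring, $[n]=\{0,\dots,n\}$ for $n\ge 0$, and $C_2=\{1,t\}$. **Functor homology.** For a small category $\mathbf C$ and functors $G\colon\mathbf C^{op}\to\mathbf{Mod}_k$, $F\colon\mathbf C\to\mathbf{Mod}_k$, let $G\otimes_{\mathbf C}F=\int^{c}G(c)\otimes_k F(c)$ (a coend), and let $\mathrm{Tor}^{\mathbf C}_\star(G,F)$ be its left derived functors; $k^*$ is the constant functor with value $k$. **Categories.** The category $\mathcal{IF}(as)$ has objects $[n]$, $n\ge0$. A morphism $f\colon[n]\to[m]$ is a map of sets together with, for each $i\in[m]$, a total order on $f^{-1}(i)$ and a label in $C_2$ for each of its elements. In a composite, $(g\circ f)^{-1}(i)$ is the ordered disjoint union $\coprod_{j^\alpha\in g^{-1}(i)}\alpha * f^{-1}(j)$, where $1$ acts trivially and $t$ reverses the order and multiplies all labels by $t$. The category $\Delta$ of order-preserving maps is a subcategory (trivial labels, fibres ordered as subsets of $[n]$), and the hyperoctahedral group $H_{n+1}=C_2^{n+1}\rtimes\Sigma_{n+1}$ is the automorphism group of $[n]$. Let $D_{n+1}\subset H_{n+1}$ be the dihedral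 subgroup generated by $R=(t,\dots,t;\,i\mapsto n-i)$ and $T=(1,\dots,1;\,i\mapsto i+1 \bmod n+1)$, and let $H^+_{n+1}\subset H_{n+1}$ be the subgroup of the $(z_0,\dots,z_n;\sigma)$ with $z_0=1$ and $\sigma(0)=0$. The dihedral category $\Delta D$ is the subcategory of $\mathcal{IF}(as)$ of all $\varphi\circ d$ with $\varphi\in\Delta([n],[m])$ and $d\in D_{n+1}$; $i\colon\Delta D\to\mathcal{IF}(as)$ is the inclusion. The hyperoctahedral category $\Delta H$ has objects $[n]$ and as morphisms $[n]\to[m]$ the pairs $(\varphi,g)$ with $\varphi\in\Delta([n],[m])$ and $g\in H_{n+1}$, composed by the crossed simplicial structure; $(\varphi,g)\mapsto\varphi\circ g$ is an isomorphism $\Delta H\cong\mathcal{IF}(as)$. **Duality.** $D\colon\Delta D^{op}\to\Delta D$ is the dihedral duality isomorphism: it is the identity on objects; it sends the coface $\delta_i\colon[n-1]\to[n]$ to the map merging $i$ and $i+1$ if $i<n$, and merging $n$ and $0$, in this order, if $i=n$; it sends the codegeneracy merging $j$ and $j+1$ to the coface omitting $j+1$; and $D(T)=T^{-1}$, $D(R)=T\circ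 R$. **The functor $B$.** Every morphism of $\mathcal{IF}(as)$ with source $[n]$ is uniquely of the form $d\circ h$ with $d$ in $\Delta D$ and $h\in H^+_{n+1}$; call $h$ its $H^+$-component. Let $B\colon\mathcal{IF}(as)^{op}\to\mathbf{Mod}_k$ be given by $B([n])=k[H^+_{n+1}]$, where $f\colon[n]\to[m]$ sends a basis element $h\in H^+_{m+1}$ to the $H^+$-component of $h\circ f$. **Theorem 9.2.** Let $F\colon\mathcal{IF}(as)\to\mathbf{Mod}_k$ be a functor, and write $HD_\star(E)=\mathrm{Tor}_\star^{\Delta D^{op}}(k^*,E)$ for the dihedral homology of $E\colon\Delta D^{op}\to\mathbf{Mod}_k$. There exist isomorphisms of graded $k$-modules $$HD_\star(F\circ i\circ D)=\mathrm{Tor}_\star^{\Delta D^{op}}(k^*,F\circ i\circ D)\;\cong\;\mathrm{Tor}_\star^{\mathcal{IF}(as)}(B,F)\;\cong\;\mathrm{Tor}_\star^{\Delta H}(B,F),$$ where in the last term $B$ and $F$ denote the functors on $\Delta H^{op}$ and $\Delta H$ obtained by composing with the isomorphism $\Delta H\cong\mathcal{IF}(as)$. -/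

import Mathlib

universe u

/-! # Functor homology over a small category -/

namespace FunctorHomology

open CategoryTheory CategoryTheory.Limits Opposite


variable {C : Type} [SmallCategory C] {k : Type u} [CommRing k]

/-- The bifunctor `(c, c') ↦ G(c) ⊗ F(c')` attached to a right module `G` and a left module `F`
over a small category, as a functor of `F`. -/
noncomputable def tensorBifunctor (G : Cᵒᵖ ⥤ ModuleCat.{u} k) :
    (C ⥤ ModuleCat.{u} k) ⥤ Cᵒᵖ ⥤ C ⥤ ModuleCat.{u} k where
  obj F :=
    { obj := fun c => F ⋙ MonoidalCategory.tensorLeft (G.obj c)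
      map := fun f => Functor.whiskerLeft F
        ((MonoidalCategory.tensoringLeft (ModuleCat.{u} k)).map (G.map f)) }
  map α := { app := fun c => Functor.whiskerRight α (MonoidalCategory.tensorLeft (G.obj c))
             naturality := fun c d f => by
               ext x : 2
               exact MonoidalCategory.whisker_exchange (G.map f) (α.app x) |>.symm }

instance tensorBifunctor_additive (G : Cᵒᵖ ⥤ ModuleCat.{u} k) :
    (tensorBifunctor G).Additive where
  map_add {F F' α β} := by
    ext c d : 4
    exact MonoidalPreadditive.whiskerLeft_add (X := G.obj c) (α.app d) (β.app d)

instance hasCoend (T : Cᵒᵖ ⥤ C ⥤ ModuleCat.{u} k) : HasCoend T := by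
  have : HasColimitsOfSize.{0, 0} (ModuleCat.{u} k) := hasColimitsOfSizeShrink.{0, 0, u, u} _
  infer_instance

instance coendFunctor_additive : (coendFunctor C (ModuleCat.{u} k)).Additive where
  map_add {T T' α β} := by
    refine coend.hom_ext fun c => ?_
    change coend.ι T c ≫ coend.map (α + β) = coend.ι T c ≫ (coend.map α + coend.map β)
    rw [Preadditive.comp_add, coend.ι_map, coend.ι_map, coend.ι_map, NatTrans.app_add,
      NatTrans.app_add, Preadditive.add_comp]

/-- The functor `F ↦ G ⊗_C F`, where `G ⊗_C F` is the coend of `G(c) ⊗ F(c)`. -/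
noncomputable def tensorFunctor (G : Cᵒᵖ ⥤ ModuleCat.{u} k) :
    (C ⥤ ModuleCat.{u} k) ⥤ ModuleCat.{u} k :=
  tensorBifunctor G ⋙ coendFunctor C (ModuleCat.{u} k)

instance tensorFunctor_additive (G : Cᵒᵖ ⥤ ModuleCat.{u} k) : (tensorFunctor G).Additive :=
  inferInstanceAs (tensorBifunctor G ⋙ coendFunctor C (ModuleCat.{u} k)).Additive

/-- The direct sum over all `c` and all `x ∈ F(c)` of the representable functors `k[Hom(c, -)]`. -/
noncomputable def freeCover (F : C ⥤ ModuleCat.{u} k) : C ⥤ ModuleCat.{u} k where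
  obj d := ModuleCat.of k ((Σ c : C, (c ⟶ d) × F.obj c) →₀ k)
  map g := ModuleCat.ofHom (Finsupp.lmapDomain k k fun p => ⟨p.1, p.2.1 ≫ g, p.2.2⟩)
  map_id d := by
    ext : 1
    refine Finsupp.lhom_ext' fun p => LinearMap.ext_ring ?_
    simp [Finsupp.mapDomain_single]
  map_comp g h := by
    ext : 1
    refine Finsupp.lhom_ext' fun p => LinearMap.ext_ring ?_
    simp [Finsupp.mapDomain_single]

/-- The generators of `freeCover F`. -/
noncomputable def freeCoverGen (F : C ⥤ ModuleCat.{u} k) {c d : C} (f : c ⟶ d) (x : F.obj c) :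
    (freeCover F).obj d :=
  (Finsupp.single ⟨c, f, x⟩ 1 : (Σ c : C, (c ⟶ d) × F.obj c) →₀ k)

lemma freeCover_map_gen (F : C ⥤ ModuleCat.{u} k) {c d e : C} (f : c ⟶ d) (g : d ⟶ e)
    (x : F.obj c) :
    ((freeCover F).map g).hom (freeCoverGen F f x) = freeCoverGen F (f ≫ g) x :=
  Finsupp.mapDomain_single

lemma freeCover_linear_ext {F : C ⥤ ModuleCat.{u} k} {d : C} {M : ModuleCat.{u} k}
    {a b : (freeCover F).obj d ⟶ M}
    (h : ∀ (c : C) (f : c ⟶ d) (x : F.obj c), a.hom (freeCoverGen F f x) =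
      b.hom (freeCoverGen F f x)) : a = b :=
  ModuleCat.hom_ext (Finsupp.lhom_ext' fun p => LinearMap.ext_ring (h p.1 p.2.1 p.2.2))

/-- Natural transformations out of `freeCover F` are given by arbitrary families of elements. -/
noncomputable def freeCoverDesc (F E : C ⥤ ModuleCat.{u} k) (s : ∀ c : C, F.obj c → E.obj c) :
    freeCover F ⟶ E where
  app d := ModuleCat.ofHom (Finsupp.linearCombination k
    fun p : (Σ c : C, (c ⟶ d) × F.obj c) => (E.map p.2.1).hom (s p.1 p.2.2))
  naturality d d' g := by
    ext : 1
    refine Finsupp.lhom_ext' fun p => LinearMap.ext_ring ?_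
    simp [freeCover, Finsupp.mapDomain_single]

lemma freeCoverDesc_gen (F E : C ⥤ ModuleCat.{u} k) (s : ∀ c : C, F.obj c → E.obj c) {c d : C}
    (f : c ⟶ d) (x : F.obj c) :
    ((freeCoverDesc F E s).app d).hom (freeCoverGen F f x) = (E.map f).hom (s c x) :=
  (Finsupp.linearCombination_single k 1 _).trans (one_smul k _)

lemma freeCover_hom_ext {F E : C ⥤ ModuleCat.{u} k} {a b : freeCover F ⟶ E}
    (h : ∀ (c : C) (x : F.obj c), (a.app c).hom (freeCoverGen F (𝟙 c) x) =
      (b.app c).hom (freeCoverGen F (𝟙 c) x)) : a = b := by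
  ext d : 2
  refine freeCover_linear_ext fun c f x => ?_
  have e := freeCover_map_gen F (𝟙 c) f x
  rw [Category.id_comp] at e
  have na := congrArg (fun t => t.hom (freeCoverGen F (𝟙 c) x)) (a.naturality f)
  have nb := congrArg (fun t => t.hom (freeCoverGen F (𝟙 c) x)) (b.naturality f)
  simp only [ModuleCat.hom_comp, LinearMap.comp_apply, e] at na nb
  rw [na, nb, h c x]

instance freeCover_projective (F : C ⥤ ModuleCat.{u} k) : Projective (freeCover F) where
  factors {E X} f e he := by
    have hs : ∀ c, Function.Surjective (e.app c).hom := fun c =>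
      (ModuleCat.epi_iff_surjective _).1 inferInstance
    refine ⟨freeCoverDesc F E fun c x => (hs c ((f.app c).hom (freeCoverGen F (𝟙 c) x))).choose,
      freeCover_hom_ext fun c x => ?_⟩
    rw [NatTrans.comp_app, ModuleCat.hom_comp, LinearMap.comp_apply, freeCoverDesc_gen]
    simpa using (hs c ((f.app c).hom (freeCoverGen F (𝟙 c) x))).choose_spec

instance enoughProjectives : EnoughProjectives (C ⥤ ModuleCat.{u} k) where
  presentation F := ⟨
    { p := freeCover F
      f := freeCoverDesc F F fun _ x => x
      epi := by
        have : ∀ c, Epi ((freeCoverDesc F F fun _ x => x).app c) := fun c => by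
          rw [ModuleCat.epi_iff_surjective]
          exact fun x => ⟨freeCoverGen F (𝟙 c) x, by
            simpa using freeCoverDesc_gen F F (fun _ x => x) (𝟙 c) x⟩
        exact NatTrans.epi_of_epi_app _ }⟩

/-- `Tor_⋆^C(G, F)` as a graded `k`-module: the left derived functors of `G ⊗_C -`, at `F`. -/
noncomputable def Tor (G : Cᵒᵖ ⥤ ModuleCat.{u} k) (F : C ⥤ ModuleCat.{u} k) :
    GradedObject ℕ (ModuleCat.{u} k) :=
  fun n => ((tensorFunctor G).leftDerived n).obj F

/-- The constant functor `k^*` with value `k`. -/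
noncomputable def constFunctor (C : Type) [SmallCategory C] (k : Type u) [CommRing k] :
    C ⥤ ModuleCat.{u} k :=
  (Functor.const C).obj (ModuleCat.of k k)

end FunctorHomology

/-! # Involutive non-commutative sets

The object `[n]` is the set `Fin (n + 1)`; the group `C₂` is `ℤˣ = {1, -1}`, with `t = -1`. -/

namespace InvolutiveNonCommSets

open CategoryTheory Opposite

/-- The effect of an element of `C₂` on an ordering: `t` reverses it. -/
def orient {α : Type} (z : ℤˣ) (r : α → α → Prop) (a b : α) : Prop :=
  (z = 1 ∧ r a b) ∨ (z = -1 ∧ r b a)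

/-- A morphism `[n] → [m]` of involutive non-commutative sets: a map of sets, a label in `C₂` on
each element of `[n]`, and a strict total order on each fibre.  The orders on the fibres are
recorded by a single relation `lt`, which relates only elements of a common fibre. -/
@[ext]
structure IHom (n m : ℕ) : Type where
  toFun : Fin (n + 1) → Fin (m + 1)
  label : Fin (n + 1) → ℤˣ
  lt : Fin (n + 1) → Fin (n + 1) → Prop
  lt_fibre : ∀ {a b}, lt a b → toFun a = toFun b
  lt_irrefl : ∀ a, ¬ lt a a
  lt_trans : ∀ {a b c}, lt a b → lt b c → lt a c
  lt_total : ∀ {a b}, toFun a = toFun b → a ≠ b → lt a b ∨ lt b a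

namespace IHom

variable {n m l p : ℕ}

/-- The identity: all labels are trivial and all fibres are singletons. -/
def id (n : ℕ) : IHom n n where
  toFun a := a
  label _ := 1
  lt _ _ := False
  lt_fibre h := h.elim
  lt_irrefl _ h := h
  lt_trans h _ := h
  lt_total h h' := (h' h).elim

/-- The composite `g ∘ f`.  Its fibre over `i` is the ordered disjoint union, over the elements
`j^α` of the fibre of `g` over `i`, of the fibres of `f` over `j` acted on by `α` (which multiplies
all labels by `α`, and reverses the order if `α = t`). -/
def comp (g : IHom m l) (f : IHom n m) : IHom n l where
  toFun a := g.toFun (f.toFun a)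
  label a := g.label (f.toFun a) * f.label a
  lt a b := g.lt (f.toFun a) (f.toFun b) ∨
    (f.toFun a = f.toFun b ∧ orient (g.label (f.toFun a)) f.lt a b)
  lt_fibre := by
    rintro a b (h | ⟨h, -⟩)
    · exact g.lt_fibre h
    · rw [h]
  lt_irrefl := by
    rintro a (h | ⟨-, ⟨-, h⟩ | ⟨-, h⟩⟩)
    · exact g.lt_irrefl _ h
    · exact f.lt_irrefl _ h
    · exact f.lt_irrefl _ h
  lt_trans := by
    rintro a b c (h | ⟨e, h⟩) (h' | ⟨e', h'⟩)
    · exact Or.inl (g.lt_trans h h')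
    · exact Or.inl (e' ▸ h)
    · exact Or.inl (e ▸ h')
    · refine Or.inr ⟨e.trans e', ?_⟩
      rw [← e] at h'
      rcases h with ⟨z, h⟩ | ⟨z, h⟩ <;> rcases h' with ⟨z', h'⟩ | ⟨z', h'⟩
      · exact Or.inl ⟨z, f.lt_trans h h'⟩
      · exact absurd (z.symm.trans z') (by decide)
      · exact absurd (z'.symm.trans z) (by decide)
      · exact Or.inr ⟨z, f.lt_trans h' h⟩
  lt_total := by
    intro a b h hab
    by_cases e : f.toFun a = f.toFun b
    · rcases Int.units_eq_one_or (g.label (f.toFun a)) with z | z <;>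
        rcases f.lt_total e hab with h' | h'
      · exact Or.inl (Or.inr ⟨e, Or.inl ⟨z, h'⟩⟩)
      · exact Or.inr (Or.inr ⟨e.symm, Or.inl ⟨e ▸ z, h'⟩⟩)
      · exact Or.inr (Or.inr ⟨e.symm, Or.inr ⟨e ▸ z, h'⟩⟩)
      · exact Or.inl (Or.inr ⟨e, Or.inr ⟨z, h'⟩⟩)
    · exact (g.lt_total h e).imp Or.inl Or.inl

lemma id_comp (f : IHom n m) : (id m).comp f = f := by
  ext a b
  · rfl
  · simp [comp, id]
  · constructor
    · rintro (h | ⟨-, ⟨-, h⟩ | ⟨h, -⟩⟩)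
      · exact h.elim
      · exact h
      · exact absurd h (by simp [id])
    · exact fun h => Or.inr ⟨f.lt_fibre h, Or.inl ⟨rfl, h⟩⟩

lemma comp_id (f : IHom n m) : f.comp (id n) = f := by
  ext a b
  · rfl
  · simp [comp, id]
  · constructor
    · rintro (h | ⟨-, ⟨-, h⟩ | ⟨-, h⟩⟩)
      · exact h
      · exact h.elim
      · exact h.elim
    · exact fun h => Or.inl h

lemma comp_assoc (h : IHom l p) (g : IHom m l) (f : IHom n m) :
    (h.comp g).comp f = h.comp (g.comp f) := by
  ext a b
  · rfl
  · simp [comp, mul_assoc]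
  · rcases Int.units_eq_one_or (h.label (g.toFun (f.toFun a))) with z | z <;>
      rcases Int.units_eq_one_or (g.label (f.toFun a)) with z' | z' <;>
      by_cases e : f.toFun a = f.toFun b <;>
      (try rw [e] at z z') <;>
      simp [comp, orient, z, z', e, g.lt_irrefl, h.lt_irrefl] <;>
      grind

end IHom

/-- The category `𝓘𝓕(as)` of involutive non-commutative sets; `⟨n⟩` is the object `[n]`. -/
structure IFas : Type where
  deg : ℕ

instance : SmallCategory IFas where
  Hom X Y := IHom X.deg Y.deg
  id X := IHom.id X.deg
  comp f g := g.comp f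
  id_comp f := f.comp_id
  comp_id f := f.id_comp
  assoc f g h := (h.comp_assoc g f).symm

/-! # The subcategory `Δ` and the hyperoctahedral groups -/

/-- Order-preserving maps as morphisms of `𝓘𝓕(as)`: trivial labels, and the fibres are ordered as
subsets of `[n]`. -/
def ofMono {n m : ℕ} (φ : Fin (n + 1) →o Fin (m + 1)) : IHom n m where
  toFun := φ
  label _ := 1
  lt a b := φ a = φ b ∧ a < b
  lt_fibre h := h.1
  lt_irrefl a h := lt_irrefl a h.2
  lt_trans h h' := ⟨h.1.trans h'.1, h.2.trans h'.2⟩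
  lt_total e h := (lt_or_gt_of_ne h).imp (fun h' => ⟨e, h'⟩) (fun h' => ⟨e.symm, h'⟩)

/-- The hyperoctahedral group `H_{n+1} = C₂^{n+1} ⋊ Σ_{n+1}`. -/
abbrev Hyp (n : ℕ) : Type :=
  (Fin (n + 1) → ℤˣ) ⋊[mulAutArrow] Equiv.Perm (Fin (n + 1))

/-- `H_{n+1}` as a group of automorphisms of `[n]` in `𝓘𝓕(as)`.  In `(z_0, …, z_n; σ)` the entry
`z_i` labels the unique element of the fibre over `i`, that is, `σ⁻¹(i)`. -/
def ofHyp {n : ℕ} (g : Hyp n) : IHom n n where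
  toFun := g.right
  label a := g.left (g.right a)
  lt _ _ := False
  lt_fibre h := h.elim
  lt_irrefl _ h := h
  lt_trans h _ := h
  lt_total h h' := (h' (g.right.injective h)).elim

lemma mulAutArrow_apply' {n : ℕ} (σ : Equiv.Perm (Fin (n + 1))) (z : Fin (n + 1) → ℤˣ)
    (a : Fin (n + 1)) :
    (mulAutArrow (M := ℤˣ) σ z) a = z (σ.symm a) := rfl

lemma ofHyp_one (n : ℕ) : ofHyp (1 : Hyp n) = IHom.id n := by
  ext <;> simp [ofHyp, IHom.id]

lemma ofHyp_mul {n : ℕ} (g h : Hyp n) : ofHyp (g * h) = (ofHyp g).comp (ofHyp h) := by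
  ext a b
  · rfl
  · simp only [ofHyp, IHom.comp, SemidirectProduct.mul_left, SemidirectProduct.mul_right,
      Pi.mul_apply, mulAutArrow_apply', Equiv.Perm.mul_apply, Equiv.symm_apply_apply]
  · simp [ofHyp, IHom.comp, orient]

lemma ofHyp_injective {n : ℕ} : Function.Injective (ofHyp : Hyp n → IHom n n) := by
  intro g h e
  have e₁ : g.right = h.right := Equiv.ext fun a => congrFun (congrArg IHom.toFun e) a
  refine SemidirectProduct.ext (funext fun a => ?_) e₁
  have := congrFun (congrArg IHom.label e) (g.right.symm a)
  simpa [ofHyp, ← e₁] using this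

/-- The element `R = (t, …, t; r)`, with `r(i) = n - i`. -/
def R (n : ℕ) : Hyp n := ⟨fun _ => -1, Fin.revPerm⟩

/-- The element `T = (1, …, 1; τ)`, with `τ(i) = i + 1` modulo `n + 1`. -/
def T (n : ℕ) : Hyp n := ⟨1, finRotate (n + 1)⟩

/-- The dihedral group `D_{n+1}`, as the subgroup of `H_{n+1}` generated by `R` and `T`. -/
def dihedral (n : ℕ) : Subgroup (Hyp n) := Subgroup.closure {R n, T n}

/-- The group `H⁺_{n+1}` of the elements `(z_0, …, z_n; σ)` of `H_{n+1}` such that `z_0 = 1` and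
`σ(0) = 0`. -/
def hypPlus (n : ℕ) : Subgroup (Hyp n) where
  carrier := {g | g.left 0 = 1 ∧ g.right 0 = 0}
  one_mem' := by simp
  mul_mem' := by
    rintro g h ⟨hg, hg'⟩ ⟨hh, hh'⟩
    have e : g.right.symm 0 = 0 := by rw [Equiv.symm_apply_eq, hg']
    refine ⟨?_, by simp [hg', hh']⟩
    rw [SemidirectProduct.mul_left, Pi.mul_apply, mulAutArrow_apply', e, hg, hh, one_mul]
  inv_mem' := by
    rintro g ⟨hg, hg'⟩
    have e : g.right.symm 0 = 0 := by rw [Equiv.symm_apply_eq, hg']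
    refine ⟨?_, by simpa using e⟩
    rw [SemidirectProduct.inv_left, mulAutArrow_apply']
    change (g.left⁻¹) (g.right 0) = 1
    rw [hg', Pi.inv_apply, hg, inv_one]

/-! # The decomposition of `𝓘𝓕(as)` into `Δ` and the hyperoctahedral groups -/

lemma exists_sorting {α : Type} [Fintype α] {N : ℕ} (hN : Fintype.card α = N)
    (r : α → α → Prop) (irr : ∀ a, ¬ r a a) (tr : ∀ a b c, r a b → r b c → r a c)
    (tot : ∀ a b, a ≠ b → r a b ∨ r b a) : ∃ σ : α ≃ Fin N, ∀ a b, r a b ↔ σ a < σ b := by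
  classical
  have : IsStrictTotalOrder α r :=
    { trichotomous := fun a b h h' => by
        by_contra hab
        exact (tot a b hab).elim h h'
      irrefl := irr
      trans := tr }
  let _ : LinearOrder α := linearOrderOfSTO r
  let e := monoEquivOfFin α hN
  exact ⟨e.symm.toEquiv, fun a b => (e.symm.lt_iff_lt (x := a) (y := b)).symm⟩

lemma sorting_unique {α : Type} {N : ℕ} {σ τ : α ≃ Fin N}
    (h : ∀ a b, σ a < σ b ↔ τ a < τ b) : σ = τ := by
  let e : Fin N ≃o Fin N :=
    { toEquiv := σ.symm.trans τ
      map_rel_iff' := by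
        intro a b
        have := h (σ.symm b) (σ.symm a)
        simp only [Equiv.apply_symm_apply] at this
        simpa using (not_congr this).symm }
  have he : e = OrderIso.refl _ := Subsingleton.elim _ _
  ext a
  have := congrArg (fun f : Fin N ≃o Fin N => f (σ a)) he
  simp [e] at this
  rw [this]

lemma comp_ofHyp_lt {n m : ℕ} (f : IHom n m) (g : Hyp n) (a b : Fin (n + 1)) :
    (f.comp (ofHyp g)).lt a b ↔ f.lt (g.right a) (g.right b) := by
  simp [IHom.comp, ofHyp, orient]

lemma ofMono_comp_ofHyp_sort {n m : ℕ} (φ : Fin (n + 1) →o Fin (m + 1)) (g : Hyp n)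
    (a b : Fin (n + 1)) :
    g.right a < g.right b ↔
      (((ofMono φ).comp (ofHyp g)).toFun a < ((ofMono φ).comp (ofHyp g)).toFun b ∨
        ((ofMono φ).comp (ofHyp g)).lt a b) := by
  rw [comp_ofHyp_lt]
  change _ ↔ (φ (g.right a) < φ (g.right b) ∨ (φ (g.right a) = φ (g.right b) ∧ _))
  constructor
  · intro h
    exact (φ.monotone h.le).lt_or_eq.imp_right fun e => ⟨e, h⟩
  · rintro (h | ⟨-, h⟩)
    · exact φ.monotone.reflect_lt h
    · exact h

lemma ofMono_comp_ofHyp_injective {n m : ℕ} {φ φ' : Fin (n + 1) →o Fin (m + 1)} {g g' : Hyp n}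
    (h : (ofMono φ).comp (ofHyp g) = (ofMono φ').comp (ofHyp g')) : φ = φ' ∧ g = g' := by
  have e : g.right = g'.right := sorting_unique fun a b => by
    rw [ofMono_comp_ofHyp_sort φ, ofMono_comp_ofHyp_sort φ', h]
  refine ⟨?_, SemidirectProduct.ext (funext fun a => ?_) e⟩
  · ext a : 2
    have := congrFun (congrArg IHom.toFun h) (g.right.symm a)
    simpa [IHom.comp, ofHyp, ofMono, ← e] using this
  · have := congrFun (congrArg IHom.label h) (g.right.symm a)
    simpa [IHom.comp, ofHyp, ofMono, ← e] using this

lemma exists_ofMono_comp_ofHyp {n m : ℕ} (f : IHom n m) :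
    ∃ (φ : Fin (n + 1) →o Fin (m + 1)) (g : Hyp n), f = (ofMono φ).comp (ofHyp g) := by
  obtain ⟨σ, hσ⟩ := exists_sorting (Fintype.card_fin (n + 1))
    (fun a b => f.toFun a < f.toFun b ∨ f.lt a b)
    (fun a h => h.elim (lt_irrefl _) (f.lt_irrefl a))
    (by
      rintro a b c (h | h) (h' | h')
      · exact Or.inl (h.trans h')
      · exact Or.inl (f.lt_fibre h' ▸ h)
      · exact Or.inl (f.lt_fibre h ▸ h')
      · exact Or.inr (f.lt_trans h h'))
    (by
      intro a b hab
      rcases lt_trichotomy (f.toFun a) (f.toFun b) with h | h | h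
      · exact Or.inl (Or.inl h)
      · exact (f.lt_total h hab).imp Or.inr Or.inr
      · exact Or.inr (Or.inl h))
  refine ⟨⟨fun a => f.toFun (σ.symm a), ?_⟩, ⟨fun a => f.label (σ.symm a), σ⟩, ?_⟩
  · intro a b hab
    by_contra hlt
    have := (hσ (σ.symm b) (σ.symm a)).1 (Or.inl (not_le.1 hlt))
    simp only [Equiv.apply_symm_apply] at this
    exact absurd hab (not_le.2 this)
  · ext a b
    · exact congrArg (fun c => (f.toFun c : ℕ)) (σ.symm_apply_apply a).symm
    · simp [IHom.comp, ofHyp, ofMono]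
    · rw [comp_ofHyp_lt]
      change _ ↔ f.toFun (σ.symm (σ a)) = f.toFun (σ.symm (σ b)) ∧ σ a < σ b
      rw [σ.symm_apply_apply, σ.symm_apply_apply, ← hσ]
      constructor
      · exact fun h => ⟨f.lt_fibre h, Or.inr h⟩
      · rintro ⟨e, h | h⟩
        · exact absurd e h.ne
        · exact h

/-! # The hyperoctahedral category `ΔH` -/

/-- A morphism `[n] → [m]` of `ΔH`: a pair `(φ, g)` of an order-preserving map `φ : [n] → [m]` and
an element `g` of `H_{n+1}`, to be thought of as `φ ∘ g`. -/
@[ext]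
structure DeltaHHom (n m : ℕ) : Type where
  mono : Fin (n + 1) →o Fin (m + 1)
  grp : Hyp n

/-- The ordering of `[l]` in which the fibres of `ψ : [l] → [n]` come in the order prescribed by
the permutation part of `g`, the fibre over `j` being reversed if `g` puts the label `t` on `j`. -/
def crossedLt {l n : ℕ} (g : Hyp n) (ψ : Fin (l + 1) →o Fin (n + 1)) (a b : Fin (l + 1)) : Prop :=
  g.right (ψ a) < g.right (ψ b) ∨
    (ψ a = ψ b ∧ orient (g.left (g.right (ψ a))) (· < ·) a b)

lemma exists_crossedPerm {l n : ℕ} (g : Hyp n) (ψ : Fin (l + 1) →o Fin (n + 1)) :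
    ∃ σ : Equiv.Perm (Fin (l + 1)), ∀ a b, crossedLt g ψ a b ↔ σ a < σ b := by
  refine exists_sorting (Fintype.card_fin _) _ ?_ ?_ ?_
  · rintro a (h | ⟨-, ⟨-, h⟩ | ⟨-, h⟩⟩) <;> exact lt_irrefl _ h
  · rintro a b c (h | ⟨e, h⟩) (h' | ⟨e', h'⟩)
    · exact Or.inl (h.trans h')
    · exact Or.inl (e' ▸ h)
    · exact Or.inl (e ▸ h')
    · refine Or.inr ⟨e.trans e', ?_⟩
      rw [← e] at h'
      rcases h with ⟨z, h⟩ | ⟨z, h⟩ <;> rcases h' with ⟨z', h'⟩ | ⟨z', h'⟩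
      · exact Or.inl ⟨z, h.trans h'⟩
      · exact absurd (z.symm.trans z') (by decide)
      · exact absurd (z'.symm.trans z) (by decide)
      · exact Or.inr ⟨z, h'.trans h⟩
  · intro a b hab
    rcases lt_trichotomy (g.right (ψ a)) (g.right (ψ b)) with h | h | h
    · exact Or.inl (Or.inl h)
    · have e := g.right.injective h
      rcases Int.units_eq_one_or (g.left (g.right (ψ a))) with z | z <;>
        rcases lt_or_gt_of_ne hab with h' | h'
      · exact Or.inl (Or.inr ⟨e, Or.inl ⟨z, h'⟩⟩)
      · exact Or.inr (Or.inr ⟨e.symm, Or.inl ⟨e ▸ z, h'⟩⟩)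
      · exact Or.inr (Or.inr ⟨e.symm, Or.inr ⟨e ▸ z, h'⟩⟩)
      · exact Or.inl (Or.inr ⟨e, Or.inr ⟨z, h'⟩⟩)
    · exact Or.inr (Or.inl h)

/-- The permutation of `[l]` which sorts `[l]` according to `crossedLt g ψ`. -/
noncomputable def crossedPerm {l n : ℕ} (g : Hyp n) (ψ : Fin (l + 1) →o Fin (n + 1)) :
    Equiv.Perm (Fin (l + 1)) :=
  (exists_crossedPerm g ψ).choose

lemma crossedPerm_spec {l n : ℕ} (g : Hyp n) (ψ : Fin (l + 1) →o Fin (n + 1))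
    (a b : Fin (l + 1)) : crossedLt g ψ a b ↔ crossedPerm g ψ a < crossedPerm g ψ b :=
  (exists_crossedPerm g ψ).choose_spec a b

/-- The order-preserving map `g_*ψ` in the crossed relation `g ∘ ψ = (g_*ψ) ∘ (ψ^*g)`. -/
noncomputable def crossedMono {l n : ℕ} (g : Hyp n) (ψ : Fin (l + 1) →o Fin (n + 1)) :
    Fin (l + 1) →o Fin (n + 1) where
  toFun a := g.right (ψ ((crossedPerm g ψ).symm a))
  monotone' := by
    intro a b hab
    by_contra hlt
    have := (crossedPerm_spec g ψ ((crossedPerm g ψ).symm b) ((crossedPerm g ψ).symm a)).1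
      (Or.inl (not_le.1 hlt))
    simp only [Equiv.apply_symm_apply] at this
    exact absurd hab (not_le.2 this)

lemma crossedMono_crossedPerm {l n : ℕ} (g : Hyp n) (ψ : Fin (l + 1) →o Fin (n + 1))
    (a : Fin (l + 1)) : crossedMono g ψ (crossedPerm g ψ a) = g.right (ψ a) :=
  congrArg (fun c => g.right (ψ c)) ((crossedPerm g ψ).symm_apply_apply a)

/-- The group element `ψ^*g` in the crossed relation `g ∘ ψ = (g_*ψ) ∘ (ψ^*g)`: every element of
the fibre of `ψ` over `j` inherits the label of `j`. -/
noncomputable def crossedGrp {l n : ℕ} (g : Hyp n) (ψ : Fin (l + 1) →o Fin (n + 1)) : Hyp l :=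
  ⟨fun a => g.left (crossedMono g ψ a), crossedPerm g ψ⟩

namespace DeltaHHom

variable {n m l : ℕ}

/-- The identity `(id, 1)`. -/
def id (n : ℕ) : DeltaHHom n n := ⟨OrderHom.id, 1⟩

/-- The composite `(φ, g) ∘ (ψ, h) = (φ ∘ g_*ψ, ψ^*g · h)`. -/
noncomputable def comp (x : DeltaHHom m l) (y : DeltaHHom n m) : DeltaHHom n l :=
  ⟨x.mono.comp (crossedMono x.grp y.mono), crossedGrp x.grp y.mono * y.grp⟩

/-- The morphism of `𝓘𝓕(as)` corresponding to `(φ, g)`, namely `φ ∘ g`. -/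
def toIHom (x : DeltaHHom n m) : IHom n m := (ofMono x.mono).comp (ofHyp x.grp)

lemma toIHom_injective : Function.Injective (toIHom : DeltaHHom n m → IHom n m) := by
  intro x y h
  obtain ⟨h₁, h₂⟩ := ofMono_comp_ofHyp_injective h
  exact DeltaHHom.ext h₁ h₂

lemma toIHom_id : (id n).toIHom = IHom.id n := by
  have : ofMono (OrderHom.id : Fin (n + 1) →o Fin (n + 1)) = IHom.id n := by
    ext a b
    · rfl
    · rfl
    · exact ⟨fun h => h.2.ne h.1, False.elim⟩
  rw [toIHom, id, this, ofHyp_one, IHom.id_comp]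

lemma ofMono_comp (φ : Fin (m + 1) →o Fin (l + 1)) (ψ : Fin (n + 1) →o Fin (m + 1)) :
    ofMono (φ.comp ψ) = (ofMono φ).comp (ofMono ψ) := by
  ext a b
  · rfl
  · simp [ofMono, IHom.comp]
  · simp only [ofMono, IHom.comp, orient, OrderHom.comp_coe, Function.comp_apply]
    constructor
    · rintro ⟨e, h⟩
      rcases (ψ.monotone h.le).lt_or_eq with h' | h'
      · exact Or.inl ⟨e, h'⟩
      · exact Or.inr ⟨h', Or.inl ⟨trivial, h', h⟩⟩
    · rintro (⟨e, h⟩ | ⟨e, ⟨-, -, h⟩ | ⟨h, -⟩⟩)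
      · exact ⟨e, ψ.monotone.reflect_lt h⟩
      · exact ⟨congrArg φ e, h⟩
      · exact absurd h (by decide)

lemma crossed_relation (g : Hyp m) (ψ : Fin (n + 1) →o Fin (m + 1)) :
    (ofHyp g).comp (ofMono ψ) = (ofMono (crossedMono g ψ)).comp (ofHyp (crossedGrp g ψ)) := by
  ext a b
  · simp [IHom.comp, ofHyp, ofMono, crossedMono_crossedPerm, crossedGrp]
  · simp [IHom.comp, ofHyp, ofMono, crossedMono_crossedPerm, crossedGrp]
  · rw [comp_ofHyp_lt]
    simp only [ofMono, crossedGrp, ← crossedPerm_spec, crossedMono_crossedPerm]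
    simp only [IHom.comp, ofHyp, orient, false_or, crossedLt]
    constructor
    · rintro ⟨e, h⟩
      refine ⟨by rw [e], Or.inr ⟨e, ?_⟩⟩
      exact h.imp (And.imp_right And.right) (And.imp_right And.right)
    · rintro ⟨e, h | ⟨e', h⟩⟩
      · exact absurd e h.ne
      · exact ⟨e', h.imp (And.imp_right fun h => ⟨e', h⟩) (And.imp_right fun h => ⟨e'.symm, h⟩)⟩

lemma toIHom_comp (x : DeltaHHom m l) (y : DeltaHHom n m) :
    (x.comp y).toIHom = x.toIHom.comp y.toIHom := by
  rw [toIHom, comp, ofMono_comp, ofHyp_mul, toIHom, toIHom, IHom.comp_assoc, IHom.comp_assoc,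
    ← IHom.comp_assoc (ofHyp x.grp), crossed_relation, IHom.comp_assoc]

end DeltaHHom

/-- The hyperoctahedral category `ΔH`; `⟨n⟩` is the object `[n]`. -/
structure DeltaH : Type where
  deg : ℕ

noncomputable instance : SmallCategory DeltaH where
  Hom X Y := DeltaHHom X.deg Y.deg
  id X := DeltaHHom.id X.deg
  comp f g := g.comp f
  id_comp f := DeltaHHom.toIHom_injective (by
    rw [DeltaHHom.toIHom_comp, DeltaHHom.toIHom_id, IHom.comp_id])
  comp_id f := DeltaHHom.toIHom_injective (by
    rw [DeltaHHom.toIHom_comp, DeltaHHom.toIHom_id, IHom.id_comp])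
  assoc f g h := DeltaHHom.toIHom_injective (by
    rw [DeltaHHom.toIHom_comp, DeltaHHom.toIHom_comp, DeltaHHom.toIHom_comp,
      DeltaHHom.toIHom_comp, IHom.comp_assoc])

/-- The isomorphism of categories `ΔH ≅ 𝓘𝓕(as)`, as a functor. -/
noncomputable def deltaHToIFas : DeltaH ⥤ IFas where
  obj X := ⟨X.deg⟩
  map f := DeltaHHom.toIHom f
  map_id _ := DeltaHHom.toIHom_id
  map_comp f g := DeltaHHom.toIHom_comp g f

/-! # The dihedral category `ΔD` as a subcategory of `𝓘𝓕(as)` -/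

/-- The morphisms of `ΔD = Δ ∘ D`: those of the form `φ ∘ d`, with `φ` order-preserving and `d` in
the dihedral group. -/
def IsDihedral {n m : ℕ} (f : IHom n m) : Prop :=
  ∃ (φ : Fin (n + 1) →o Fin (m + 1)) (d : Hyp n), d ∈ dihedral n ∧ f = (ofMono φ).comp (ofHyp d)

/-- The residue of an integer modulo `n + 1`. -/
def res (n : ℕ) (x : ℤ) : Fin (n + 1) :=
  ⟨(x % (n + 1)).toNat, by
    have h₁ := Int.emod_nonneg x (show ((n : ℤ) + 1) ≠ 0 by omega)
    have h₂ := Int.emod_lt_of_pos x (show (0 : ℤ) < (n : ℤ) + 1 by omega)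
    omega⟩

lemma res_cast {n : ℕ} (x : ℤ) : ((res n x : ℕ) : ℤ) = x % (n + 1) :=
  Int.toNat_of_nonneg (Int.emod_nonneg x (by omega))

lemma res_eq_iff {n : ℕ} {x y : ℤ} : res n x = res n y ↔ ∃ k : ℤ, y = x + k * (n + 1) := by
  rw [Fin.ext_iff, ← Int.natCast_inj, res_cast, res_cast, Int.emod_eq_emod_iff_emod_sub_eq_zero,
    ← Int.dvd_iff_emod_eq_zero]
  constructor
  · rintro ⟨k, hk⟩
    exact ⟨-k, by linarith⟩
  · rintro ⟨k, hk⟩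
    exact ⟨-k, by rw [hk]; ring⟩

lemma res_coe {n : ℕ} (a : Fin (n + 1)) : res n ((a : ℕ) : ℤ) = a := by
  rw [Fin.ext_iff, ← Int.natCast_inj, res_cast]
  exact Int.emod_eq_of_lt (by omega) (by have := a.2; omega)

/-- A periodic monotone (`sign = 1`) or antitone (`sign = -1`) map `ℤ → ℤ`.  It describes a
morphism `[n] → [m]` of `ΔD`, in terms of the infinite periodic words on `[n]` and `[m]`. -/
structure Lift (n m : ℕ) : Type where
  sign : ℤˣ
  toFun : ℤ → ℤ
  mono : ∀ {x y : ℤ}, x ≤ y → (sign : ℤ) * toFun x ≤ sign * toFun y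
  period : ∀ x : ℤ, toFun (x + (n + 1)) = toFun x + sign * (m + 1)

namespace Lift

variable {n m l : ℕ}

lemma period_mul (F : Lift n m) (x k : ℤ) :
    F.toFun (x + k * (n + 1)) = F.toFun x + k * (F.sign * (m + 1)) := by
  induction k using Int.induction_on with
  | zero => simp
  | succ i ih =>
    have := F.period (x + i * (n + 1))
    rw [show x + ((i : ℤ) + 1) * (n + 1) = x + i * (n + 1) + (n + 1) by ring, this, ih]
    ring
  | pred i ih =>
    have := F.period (x + (-(i : ℤ) - 1) * (n + 1))
    rw [show x + (-(i : ℤ) - 1) * (n + 1) + (n + 1) = x + -i * (n + 1) by ring, ih] at this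
    linarith

lemma sign_mul_self (z : ℤˣ) : (z : ℤ) * z = 1 := by
  rcases Int.units_eq_one_or z with h | h <;> simp [h]

lemma res_congr (F : Lift n m) {x y : ℤ} (h : res n x = res n y) :
    res m (F.toFun x) = res m (F.toFun y) := by
  obtain ⟨k, rfl⟩ := res_eq_iff.1 h
  exact res_eq_iff.2 ⟨k * F.sign, by rw [F.period_mul]; ring⟩

lemma eq_of_res (F : Lift n m) {x y : ℤ} (h : res n x = res n y) (e : F.toFun x = F.toFun y) :
    x = y := by
  obtain ⟨k, rfl⟩ := res_eq_iff.1 h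
  rw [F.period_mul] at e
  have hz : k * ((F.sign : ℤ) * (m + 1)) = 0 := by linarith
  rcases mul_eq_zero.1 hz with h0 | h0
  · simp [h0]
  · rcases mul_eq_zero.1 h0 with h1 | h1
    · exact absurd h1 F.sign.ne_zero
    · omega

/-- Move a pair of points with equal values by a common period. -/
lemma shift_pair (F : Lift n m) {x y x' : ℤ} (e : F.toFun x = F.toFun y) (h : res n x = res n x') :
    ∃ y', res n y = res n y' ∧ F.toFun x' = F.toFun y' ∧ y' - x' = y - x := by
  obtain ⟨k, rfl⟩ := res_eq_iff.1 h
  exact ⟨y + k * (n + 1), res_eq_iff.2 ⟨k, rfl⟩, by rw [F.period_mul, F.period_mul, e], by ring⟩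

/-- The morphism of `𝓘𝓕(as)` described by a periodic map `F`: its underlying map is `F` modulo
periods, all its labels are equal to the sign, and its fibres are ordered by comparing those
representatives of the elements at which `F` takes the same value. -/
def toIHom (F : Lift n m) : IHom n m where
  toFun a := res m (F.toFun a)
  label _ := F.sign
  lt a b := ∃ x y : ℤ, res n x = a ∧ res n y = b ∧ F.toFun x = F.toFun y ∧ orient F.sign (· < ·) x y
  lt_fibre := by
    rintro a b ⟨x, y, rfl, rfl, e, -⟩
    rw [F.res_congr (res_coe (res n x)), e, ← F.res_congr (res_coe (res n y))]
  lt_irrefl := by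
    rintro a ⟨x, y, hx, hy, e, h⟩
    obtain rfl := F.eq_of_res (hx.trans hy.symm) e
    rcases h with ⟨-, h⟩ | ⟨-, h⟩ <;> exact lt_irrefl _ h
  lt_trans := by
    rintro a b c ⟨x, y, hx, hy, e, h⟩ ⟨y', z, hy', hz, e', h'⟩
    obtain ⟨z', hz', e'', d⟩ := F.shift_pair e' (hy'.trans hy.symm)
    refine ⟨x, z', hx, hz'.symm.trans hz, e.trans e'', ?_⟩
    rcases h with ⟨s, h⟩ | ⟨s, h⟩ <;> rcases h' with ⟨s', h'⟩ | ⟨s', h'⟩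
    · exact Or.inl ⟨s, by omega⟩
    · exact absurd (s.symm.trans s') (by decide)
    · exact absurd (s.symm.trans s') (by decide)
    · exact Or.inr ⟨s, by omega⟩
  lt_total := by
    intro a b h hab
    obtain ⟨k, hk⟩ := res_eq_iff.1 h
    have e : F.toFun a = F.toFun ((b : ℤ) + (-k * F.sign) * (n + 1)) := by
      rw [F.period_mul, hk]
      have := sign_mul_self F.sign
      linear_combination (k * (m + 1)) * this
    have hb : res n ((b : ℤ) + (-k * F.sign) * (n + 1)) = b :=
      (res_eq_iff.2 ⟨_, rfl⟩ : res n (b : ℤ) = _).symm.trans (res_coe b)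
    have ne : ((a : ℕ) : ℤ) ≠ (b : ℤ) + (-k * F.sign) * (n + 1) := fun h' =>
      hab ((res_coe a).symm.trans ((congrArg (res n) h').trans hb))
    rcases Int.units_eq_one_or F.sign with s | s <;> rcases lt_or_gt_of_ne ne with h' | h'
    · exact Or.inl ⟨_, _, res_coe a, hb, e, Or.inl ⟨s, h'⟩⟩
    · exact Or.inr ⟨_, _, hb, res_coe a, e.symm, Or.inl ⟨s, h'⟩⟩
    · exact Or.inr ⟨_, _, hb, res_coe a, e.symm, Or.inr ⟨s, h'⟩⟩
    · exact Or.inl ⟨_, _, res_coe a, hb, e, Or.inr ⟨s, h'⟩⟩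

lemma toIHom_toFun_res (F : Lift n m) (x : ℤ) : F.toIHom.toFun (res n x) = res m (F.toFun x) :=
  F.res_congr (res_coe _)

/-- The composite of periodic maps. -/
def comp (G : Lift m l) (F : Lift n m) : Lift n l where
  sign := G.sign * F.sign
  toFun x := G.toFun (F.toFun x)
  mono {x y} h := by
    have hF := F.mono h
    rcases Int.units_eq_one_or F.sign with s | s <;> rw [s] at hF ⊢
    · have := G.mono (x := F.toFun x) (y := F.toFun y) (by simpa using hF)
      simpa using this
    · have := G.mono (x := F.toFun y) (y := F.toFun x) (by simpa using hF)
      simpa using this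
  period x := by
    rw [F.period, G.period_mul]
    push_cast
    ring

lemma toIHom_comp (G : Lift m l) (F : Lift n m) :
    (G.comp F).toIHom = G.toIHom.comp F.toIHom := by
  ext a b
  · exact congrArg Fin.val (G.toIHom_toFun_res (F.toFun a)).symm
  · rfl
  · constructor
    · rintro ⟨x, y, rfl, rfl, e, h⟩
      change G.toFun (F.toFun x) = G.toFun (F.toFun y) at e
      change orient (G.sign * F.sign) _ x y at h
      by_cases e' : F.toFun x = F.toFun y
      · refine Or.inr ⟨?_, ?_⟩
        · rw [toIHom_toFun_res, toIHom_toFun_res, e']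
        · change orient G.sign _ _ _
          rcases Int.units_eq_one_or G.sign with s | s
          · refine Or.inl ⟨s, x, y, rfl, rfl, e', ?_⟩
            simpa [s] using h
          · refine Or.inr ⟨s, y, x, rfl, rfl, e'.symm, ?_⟩
            rcases Int.units_eq_one_or F.sign with s' | s' <;> simpa [s, s', orient] using h
      · refine Or.inl ⟨F.toFun x, F.toFun y, ?_, ?_, e, ?_⟩
        · rw [toIHom_toFun_res]
        · rw [toIHom_toFun_res]
        · have key : ∀ {u v : ℤ}, u < v → F.toFun u ≠ F.toFun v →
              orient F.sign (· < ·) (F.toFun u) (F.toFun v) := by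
            intro u v huv hne
            have := F.mono huv.le
            rcases Int.units_eq_one_or F.sign with s | s <;> rw [s] at this
            · exact Or.inl ⟨s, lt_of_le_of_ne (by simpa using this) hne⟩
            · exact Or.inr ⟨s, lt_of_le_of_ne (by simpa using this) (Ne.symm hne)⟩
          rcases h with ⟨s, h⟩ | ⟨s, h⟩
          · have k := key h e'
            rcases Int.units_eq_one_or F.sign with s' | s' <;>
              rcases Int.units_eq_one_or G.sign with s'' | s'' <;>
              simp [s', s'', orient] at s k ⊢ <;> exact k
          · have k := key h (Ne.symm e')
            rcases Int.units_eq_one_or F.sign with s' | s' <;>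
              rcases Int.units_eq_one_or G.sign with s'' | s'' <;>
              simp [s', s'', orient] at s k ⊢ <;> exact k
    · rintro (⟨u, v, hu, hv, e, h⟩ | ⟨e, h⟩)
      · change res m u = res m (F.toFun a) at hu
        change res m v = res m (F.toFun b) at hv
        obtain ⟨i, hi⟩ := res_eq_iff.1 hu.symm
        obtain ⟨j, hj⟩ := res_eq_iff.1 hv.symm
        have hs := sign_mul_self F.sign
        have hx : F.toFun ((a : ℤ) + (i * F.sign) * (n + 1)) = u := by
          rw [F.period_mul, hi]; linear_combination (i * (m + 1)) * hs
        have hy : F.toFun ((b : ℤ) + (j * F.sign) * (n + 1)) = v := by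
          rw [F.period_mul, hj]; linear_combination (j * (m + 1)) * hs
        refine ⟨(a : ℤ) + (i * F.sign) * (n + 1), (b : ℤ) + (j * F.sign) * (n + 1),
          (res_eq_iff.2 ⟨_, rfl⟩ : res n (a : ℤ) = _).symm.trans (res_coe a),
          (res_eq_iff.2 ⟨_, rfl⟩ : res n (b : ℤ) = _).symm.trans (res_coe b), ?_, ?_⟩
        · change G.toFun (F.toFun _) = G.toFun (F.toFun _)
          rw [hx, hy, e]
        · change orient (G.sign * F.sign) _ _ _
          generalize (a : ℤ) + (i * F.sign) * (n + 1) = x at *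
          generalize (b : ℤ) + (j * F.sign) * (n + 1) = y at *
          have k₁ : x ≤ y → _ := fun h => F.mono h
          have k₂ : y ≤ x → _ := fun h => F.mono h
          rw [hx, hy] at k₁ k₂
          rcases Int.units_eq_one_or F.sign with s' | s' <;>
            rcases Int.units_eq_one_or G.sign with s'' | s'' <;>
            simp [s', s'', orient] at h k₁ k₂ ⊢ <;> omega
      · change res m (F.toFun a) = res m (F.toFun b) at e
        change orient G.sign _ _ _ at h
        rcases h with ⟨s, x, y, hx, hy, e', h⟩ | ⟨s, x, y, hx, hy, e', h⟩
        · refine ⟨x, y, hx, hy, congrArg G.toFun e', ?_⟩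
          change orient (G.sign * F.sign) _ _ _
          simpa [s] using h
        · refine ⟨y, x, hy, hx, congrArg G.toFun e'.symm, ?_⟩
          change orient (G.sign * F.sign) _ _ _
          rcases Int.units_eq_one_or F.sign with s' | s' <;> simpa [s, s', orient] using h

/-- Two periodic maps describe the same morphism only if they differ by a period. -/
lemma exists_eq_add (F F' : Lift n m) (h : F.toIHom = F'.toIHom) :
    F'.sign = F.sign ∧ ∃ k : ℤ, ∀ x, F'.toFun x = F.toFun x + k * (m + 1) := by
  have hs : F'.sign = F.sign := (congrFun (congrArg IHom.label h) 0).symm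
  refine ⟨hs, ?_⟩
  have hr : ∀ x, res m (F.toFun x) = res m (F'.toFun x) := fun x => by
    rw [← toIHom_toFun_res, ← toIHom_toFun_res, h]
  have hm : (0 : ℤ) < (m : ℤ) + 1 := by omega
  have hn : (0 : ℤ) < (n : ℤ) + 1 := by omega
  -- a step of size zero is visible in the ordering of the fibres
  have flat : ∀ G G' : Lift n m, G.toIHom = G'.toIHom → G'.sign = G.sign → ∀ x,
      G.toFun x = G.toFun (x + 1) → G'.toFun (x + 1) = G'.toFun x + G'.sign * (m + 1) → False := by
    intro G G' hG hsg x e e'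
    have hne : res n x ≠ res n (x + 1) := fun hc => by
      have := G.eq_of_res hc e
      omega
    have hb : res n (x + 1) = res n (x + 1 + (-1) * (n + 1)) := res_eq_iff.2 ⟨_, rfl⟩
    have e'' : G'.toFun (x + 1 + (-1) * (n + 1)) = G'.toFun x := by
      rw [G'.period_mul, e']; ring
    have n0 : 0 < n := by
      rcases Nat.eq_zero_or_pos n with rfl | h0
      · exact absurd (res_eq_iff.2 ⟨1, by simp⟩) hne
      · exact h0
    rcases Int.units_eq_one_or G.sign with s | s
    · have l₁ : G.toIHom.lt (res n x) (res n (x + 1)) :=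
        ⟨x, x + 1, rfl, rfl, e, Or.inl ⟨s, by omega⟩⟩
      have l₂ : G'.toIHom.lt (res n (x + 1)) (res n x) :=
        ⟨_, x, hb.symm, rfl, e'', Or.inl ⟨hsg.trans s, by omega⟩⟩
      exact G.toIHom.lt_irrefl _ (G.toIHom.lt_trans l₁ (hG ▸ l₂))
    · have l₁ : G.toIHom.lt (res n (x + 1)) (res n x) :=
        ⟨x + 1, x, rfl, rfl, e.symm, Or.inr ⟨s, by omega⟩⟩
      have l₂ : G'.toIHom.lt (res n x) (res n (x + 1)) :=
        ⟨x, _, rfl, hb.symm, e''.symm, Or.inr ⟨hsg.trans s, by omega⟩⟩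
      exact G.toIHom.lt_irrefl _ (G.toIHom.lt_trans l₁ (hG ▸ l₂))
  -- each step has size between `0` and the period
  have step : ∀ G : Lift n m, ∀ x, 0 ≤ (G.sign : ℤ) * (G.toFun (x + 1) - G.toFun x) ∧
      (G.sign : ℤ) * (G.toFun (x + 1) - G.toFun x) ≤ m + 1 := by
    intro G x
    have h₁ := G.mono (show x ≤ x + 1 by omega)
    have h₂ := G.mono (show x + 1 ≤ x + (n + 1) by omega)
    rw [G.period] at h₂
    have hs := sign_mul_self G.sign
    constructor
    · linarith
    · have : (G.sign : ℤ) * (G.toFun x + G.sign * (m + 1)) = G.sign * G.toFun x + (m + 1) := by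
        linear_combination (m + 1 : ℤ) * hs
      linarith
  have same : ∀ x, F'.toFun (x + 1) - F'.toFun x = F.toFun (x + 1) - F.toFun x := by
    intro x
    obtain ⟨i, hi⟩ := res_eq_iff.1 (hr x)
    obtain ⟨j, hj⟩ := res_eq_iff.1 (hr (x + 1))
    have s₁ := step F x
    have s₂ := step F' x
    rw [hs] at s₂
    have hd : (F.sign : ℤ) * (F'.toFun (x + 1) - F'.toFun x) =
        F.sign * (F.toFun (x + 1) - F.toFun x) + (F.sign * (j - i)) * (m + 1) := by
      rw [hi, hj]; ring
    have hss := sign_mul_self F.sign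
    set q : ℤ := F.sign * (j - i) with hq
    have hq1 : q ≤ 1 := by
      by_contra hc
      have : 2 * ((m : ℤ) + 1) ≤ q * (m + 1) := by
        apply mul_le_mul_of_nonneg_right <;> omega
      omega
    have hq2 : -1 ≤ q := by
      by_contra hc
      have : q * ((m : ℤ) + 1) ≤ (-2) * (m + 1) := by
        apply mul_le_mul_of_nonneg_right <;> omega
      omega
    have cancel : ∀ {u v : ℤ}, (F.sign : ℤ) * u = v → u = F.sign * v := by
      intro u v huv
      rw [← huv, ← mul_assoc, hss, one_mul]
    obtain hq' | hq' | hq' : q = -1 ∨ q = 0 ∨ q = 1 := by omega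
    · exfalso
      rw [hq'] at hd
      have a₁ : (F.sign : ℤ) * (F'.toFun (x + 1) - F'.toFun x) = 0 := by omega
      have a₂ : (F.sign : ℤ) * (F.toFun (x + 1) - F.toFun x) = m + 1 := by omega
      have b₁ := cancel a₁
      have b₂ := cancel a₂
      exact flat F' F h.symm hs.symm x (by linarith) (by linarith)
    · have : (j - i) = F.sign * 0 := cancel (by rw [← hq, hq'])
      rw [hi, hj]
      have : j = i := by linarith
      rw [this]; ring
    · exfalso
      rw [hq'] at hd
      have a₁ : (F.sign : ℤ) * (F.toFun (x + 1) - F.toFun x) = 0 := by omega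
      have a₂ : (F.sign : ℤ) * (F'.toFun (x + 1) - F'.toFun x) = m + 1 := by omega
      have b₁ := cancel a₁
      have b₂ := cancel a₂
      exact flat F F' h hs x (by linarith) (by rw [hs]; linarith)
  obtain ⟨k, hk⟩ := res_eq_iff.1 (hr 0)
  refine ⟨k, fun x => ?_⟩
  induction x using Int.induction_on with
  | zero => exact hk
  | succ i ih => have := same i; linarith
  | pred i ih =>
    have := same (-(i : ℤ) - 1)
    rw [sub_add_cancel] at this
    linarith

lemma toIHom_eq_of_add (F F' : Lift n m) (hs : F'.sign = F.sign) (k : ℤ)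
    (hk : ∀ x, F'.toFun x = F.toFun x + k * (m + 1)) : F'.toIHom = F.toIHom := by
  ext a b
  · exact congrArg Fin.val (res_eq_iff.2 ⟨k, hk _⟩).symm
  · exact congrArg (fun z : ℤˣ => (z : ℤ)) hs
  · simp [toIHom, hk, hs]

/-- `F` is to the right of `j` at `i`, in the sense of its orientation. -/
def Beyond (F : Lift n m) (j i : ℤ) : Prop :=
  (F.sign = 1 ∧ j ≤ F.toFun i) ∨ (F.sign = -1 ∧ F.toFun i < j)

lemma exists_dual (F : Lift n m) (j : ℤ) : ∃ s : ℤ, ∀ i, s ≤ i ↔ F.Beyond j i := by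
  have hm : (0 : ℤ) < (m : ℤ) + 1 := by omega
  have hn : (0 : ℤ) < (n : ℤ) + 1 := by omega
  have up : ∀ {i i' : ℤ}, i ≤ i' → F.Beyond j i → F.Beyond j i' := by
    rintro i i' h (⟨s, hb⟩ | ⟨s, hb⟩)
    · have := F.mono h
      rw [s] at this
      exact Or.inl ⟨s, by simp at this; omega⟩
    · have := F.mono h
      rw [s] at this
      exact Or.inr ⟨s, by simp at this; omega⟩
  have p := F.period_mul 0
  set N : ℤ := |F.toFun 0| + |j| + 1 with hN
  have hN0 : 0 ≤ N := by positivity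
  have b₁ := neg_abs_le (F.toFun 0)
  have b₂ := le_abs_self (F.toFun 0)
  have b₃ := neg_abs_le j
  have b₄ := le_abs_self j
  have hNm : N ≤ N * (m + 1) := le_mul_of_one_le_right hN0 (by omega)
  have above : F.Beyond j (0 + N * (n + 1)) := by
    have := p N
    rcases Int.units_eq_one_or F.sign with s | s <;> rw [s] at this
    · exact Or.inl ⟨s, by push_cast at this; linarith⟩
    · exact Or.inr ⟨s, by push_cast at this; linarith⟩
  have below : ¬ F.Beyond j (0 + (-N) * (n + 1)) := by
    have := p (-N)
    rcases Int.units_eq_one_or F.sign with s | s <;> rw [s] at this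
    · rintro (⟨-, hb⟩ | ⟨s', -⟩)
      · push_cast at this; linarith
      · exact absurd (s.symm.trans s') (by decide)
    · rintro (⟨s', -⟩ | ⟨-, hb⟩)
      · exact absurd (s.symm.trans s') (by decide)
      · push_cast at this; linarith
  obtain ⟨s, hs, hmin⟩ := Int.exists_least_of_bdd (P := F.Beyond j)
    ⟨0 + (-N) * (n + 1), fun z hz => le_of_lt (lt_of_not_ge fun hc => below (up hc hz))⟩ ⟨_, above⟩
  exact ⟨s, fun i => ⟨fun h => up h hs, hmin i⟩⟩

/-- The value at `j` of the dual of `F`: the least `i` such that `j ≤ F i` (if `F` is monotone) or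
`F i < j` (if `F` is antitone). -/
noncomputable def dualFun (F : Lift n m) (j : ℤ) : ℤ := (F.exists_dual j).choose

lemma dualFun_le (F : Lift n m) (j i : ℤ) : F.dualFun j ≤ i ↔ F.Beyond j i :=
  (F.exists_dual j).choose_spec i

lemma eq_dualFun (F : Lift n m) {j s : ℤ} (h : ∀ i, s ≤ i ↔ F.Beyond j i) : s = F.dualFun j :=
  le_antisymm ((h _).2 ((F.dualFun_le _ _).1 le_rfl)) ((F.dualFun_le _ _).2 ((h _).1 le_rfl))

/-- The dual of a periodic map: `j` stands for the gap between `j - 1` and `j`, and the dual sends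
it to the gap into which `F` maps it back. -/
noncomputable def dual (F : Lift n m) : Lift m n where
  sign := F.sign
  toFun := F.dualFun
  mono {x y} h := by
    rcases Int.units_eq_one_or F.sign with s | s <;> rw [s]
    · have : F.dualFun x ≤ F.dualFun y := by
        rw [dualFun_le]
        rcases (F.dualFun_le y _).1 le_rfl with ⟨-, hb⟩ | ⟨s', -⟩
        · exact Or.inl ⟨s, h.trans hb⟩
        · exact absurd (s.symm.trans s') (by decide)
      simpa using this
    · have : F.dualFun y ≤ F.dualFun x := by
        rw [dualFun_le]
        rcases (F.dualFun_le x _).1 le_rfl with ⟨s', -⟩ | ⟨-, hb⟩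
        · exact absurd (s.symm.trans s') (by decide)
        · exact Or.inr ⟨s, lt_of_lt_of_le hb h⟩
      simpa using this
  period x := by
    symm
    refine F.eq_dualFun fun i => ?_
    have h := F.dualFun_le x (i + -F.sign * (n + 1))
    have p := F.period_mul i (-F.sign)
    have hs := sign_mul_self F.sign
    have p' : F.toFun (i + -F.sign * (n + 1)) = F.toFun i - (m + 1) := by
      rw [p]; linear_combination (-(m + 1 : ℤ)) * hs
    rw [Beyond, p'] at h
    rw [Beyond, show (F.dualFun x + F.sign * (n + 1) ≤ i) ↔
      (F.dualFun x ≤ i + -F.sign * (n + 1)) by constructor <;> intro h <;> linarith, h]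
    constructor <;> rintro (⟨s, h⟩ | ⟨s, h⟩)
    · exact Or.inl ⟨s, by linarith⟩
    · exact Or.inr ⟨s, by linarith⟩
    · exact Or.inl ⟨s, by linarith⟩
    · exact Or.inr ⟨s, by linarith⟩

lemma dual_comp (G : Lift m l) (F : Lift n m) (x : ℤ) :
    (G.comp F).dual.toFun x = (F.dual.comp G.dual).toFun x := by
  symm
  refine (G.comp F).eq_dualFun fun i => ?_
  change F.dualFun (G.dualFun x) ≤ i ↔ ((G.sign * F.sign = 1 ∧ x ≤ G.toFun (F.toFun i)) ∨
    (G.sign * F.sign = -1 ∧ G.toFun (F.toFun i) < x))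
  have hG := G.dualFun_le x (F.toFun i)
  rw [Beyond] at hG
  rw [F.dualFun_le, Beyond, ← not_le (a := G.dualFun x), hG]
  rcases Int.units_eq_one_or F.sign with s' | s' <;>
    rcases Int.units_eq_one_or G.sign with s'' | s'' <;>
    simp [s', s'']

lemma dual_congr (F F' : Lift n m) (h : F.toIHom = F'.toIHom) :
    F.dual.toIHom = F'.dual.toIHom := by
  obtain ⟨hs, k, hk⟩ := F.exists_eq_add F' h
  refine toIHom_eq_of_add F'.dual F.dual hs.symm (k * F.sign) fun x => ?_
  have : F'.dualFun x = F.dualFun x + (-k * F.sign) * (n + 1) := by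
    symm
    refine F'.eq_dualFun fun i => ?_
    have h := F.dualFun_le x (i + (k * F.sign) * (n + 1))
    have p := F.period_mul i (k * F.sign)
    have hss := sign_mul_self F.sign
    have p' : F.toFun (i + (k * F.sign) * (n + 1)) = F'.toFun i := by
      rw [p, hk]; linear_combination (k * (m + 1 : ℤ)) * hss
    rw [Beyond, p', ← hs] at h
    rw [Beyond, ← h]
    rw [hs]
    constructor <;> intro h <;> linarith
  change F.dualFun x = F'.dualFun x + _
  rw [this]; ring

end Lift

namespace Lift

variable {n m l : ℕ}

/-- The periodic extension of an order-preserving map. -/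
def ofMono (φ : Fin (n + 1) →o Fin (m + 1)) : Lift n m where
  sign := 1
  toFun x := φ (res n x) + (x / (n + 1)) * (m + 1)
  mono {x y} h := by
    have hn : (0 : ℤ) < (n : ℤ) + 1 := by omega
    have hd := Int.ediv_le_ediv hn h
    simp only [Units.val_one, one_mul]
    rcases hd.lt_or_eq with hd | hd
    · have h₁ := (φ (res n x)).2
      have h₂ : (x / ((n : ℤ) + 1) + 1) * ((m : ℤ) + 1) ≤ (y / ((n : ℤ) + 1)) * ((m : ℤ) + 1) :=
        mul_le_mul_of_nonneg_right hd (by omega)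
      have h₃ : ((φ (res n x) : ℕ) : ℤ) < m + 1 := by omega
      have h₄ : (0 : ℤ) ≤ ((φ (res n y) : ℕ) : ℤ) := by omega
      linarith
    · have : res n x ≤ res n y := by
        rw [Fin.le_def, ← Int.ofNat_le, res_cast, res_cast, Int.emod_def, Int.emod_def, hd]
        omega
      have := φ.monotone this
      rw [Fin.le_def, ← Int.ofNat_le] at this
      rw [hd]
      omega
  period x := by
    have : res n (x + (n + 1)) = res n x := (res_eq_iff.2 ⟨1, by ring⟩).symm
    rw [this, Int.add_ediv_of_dvd_right (dvd_refl _), Int.ediv_self (by omega)]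
    push_cast
    ring

lemma ofMono_coe (φ : Fin (n + 1) →o Fin (m + 1)) (a : Fin (n + 1)) :
    (ofMono φ).toFun a = φ a := by
  have h : ((a : ℕ) : ℤ) / (n + 1) = 0 := Int.ediv_eq_zero_of_lt (by omega) (by omega)
  change ((φ (res n a) : ℕ) : ℤ) + _ = _
  rw [res_coe, h]
  ring

lemma toIHom_ofMono (φ : Fin (n + 1) →o Fin (m + 1)) :
    (ofMono φ).toIHom = InvolutiveNonCommSets.ofMono φ := by
  have h₁ : (ofMono φ).toIHom.toFun = φ := funext fun a => by
    change res m ((ofMono φ).toFun a) = φ a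
    rw [ofMono_coe, res_coe]
  have key : ∀ a b, (InvolutiveNonCommSets.ofMono φ).lt a b → (ofMono φ).toIHom.lt a b := by
    rintro a b ⟨e, h⟩
    exact ⟨a, b, res_coe a, res_coe b, by rw [ofMono_coe, ofMono_coe, e], Or.inl ⟨rfl, by
      have := Fin.lt_def.1 h
      omega⟩⟩
  ext a b
  · rw [h₁]; rfl
  · rfl
  · refine ⟨fun h => ?_, key a b⟩
    have e : φ a = φ b := by
      have := (ofMono φ).toIHom.lt_fibre h
      rwa [h₁] at this
    rcases lt_trichotomy a b with h' | h' | h'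
    · exact ⟨e, h'⟩
    · exact absurd (h' ▸ h) ((ofMono φ).toIHom.lt_irrefl _)
    · exact absurd ((ofMono φ).toIHom.lt_trans h (key _ _ ⟨e.symm, h'⟩))
        ((ofMono φ).toIHom.lt_irrefl _)

/-- The map `x ↦ z x + c`. -/
def affine (n : ℕ) (z : ℤˣ) (c : ℤ) : Lift n n where
  sign := z
  toFun x := z * x + c
  mono {x y} h := by
    have := sign_mul_self z
    have e : ∀ u : ℤ, (z : ℤ) * (z * u + c) = u + z * c := fun u => by linear_combination u * this
    rw [e, e]
    linarith
  period x := by ring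

lemma affine_lt (z : ℤˣ) (c : ℤ) (a b : Fin (n + 1)) : ¬ (affine n z c).toIHom.lt a b := by
  rintro ⟨x, y, -, -, e, h⟩
  change (z : ℤ) * x + c = z * y + c at e
  have := sign_mul_self z
  have hxy : x = y := by linear_combination z * e + (y - x) * this
  subst hxy
  rcases h with ⟨-, h⟩ | ⟨-, h⟩ <;> exact lt_irrefl _ h

lemma affine_congr (z : ℤˣ) (c k : ℤ) :
    (affine n z (c + k * (n + 1))).toIHom = (affine n z c).toIHom :=
  toIHom_eq_of_add _ _ rfl k fun x => by
    change (z : ℤ) * x + _ = z * x + c + _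
    ring

lemma affine_one_zero : (affine n 1 0).toIHom = IHom.id n := by
  ext a b
  · change ((res n (((1 : ℤˣ) : ℤ) * a + 0) : Fin (n + 1)) : ℕ) = a
    rw [Units.val_one, one_mul, add_zero, res_coe]
  · rfl
  · exact ⟨fun h => affine_lt _ _ _ _ h, False.elim⟩

lemma affine_comp (z z' : ℤˣ) (c c' : ℤ) :
    (affine n z c).comp (affine n z' c') = affine n (z * z') (z * c' + c) := by
  have : ∀ x : ℤ, (z : ℤ) * (z' * x + c') + c = (z * z' : ℤˣ) * x + (z * c' + c) := fun x => by
    push_cast; ring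
  simp only [comp, affine, this]

lemma affine_T : (affine n 1 1).toIHom = ofHyp (T n) := by
  ext a b
  · change ((res n (((1 : ℤˣ) : ℤ) * a + 1) : Fin (n + 1)) : ℕ) = (finRotate (n + 1) a : ℕ)
    rw [finRotate_apply, ← Int.natCast_inj, res_cast, Fin.val_add_one]
    split_ifs with h
    · subst h
      simp
    · have : (a : ℕ) ≠ n := fun h' => h (Fin.ext h')
      have := a.2
      rw [Units.val_one, one_mul, Int.emod_eq_of_lt] <;> omega
  · rfl
  · exact ⟨fun h => affine_lt _ _ _ _ h, False.elim⟩

lemma affine_R : (affine n (-1) n).toIHom = ofHyp (R n) := by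
  ext a b
  · change ((res n (((-1 : ℤˣ) : ℤ) * a + n) : Fin (n + 1)) : ℕ) = (Fin.rev a : ℕ)
    have := a.2
    rw [← Int.natCast_inj, res_cast, Fin.val_rev, Units.val_neg, Units.val_one,
      Int.emod_eq_of_lt] <;> omega
  · rfl
  · exact ⟨fun h => affine_lt _ _ _ _ h, False.elim⟩

lemma exists_affine_of_mem {d : Hyp n} (hd : d ∈ dihedral n) :
    ∃ z c, (affine n z c).toIHom = ofHyp d := by
  induction hd using Subgroup.closure_induction with
  | mem x hx =>
    rcases hx with rfl | rfl
    · exact ⟨_, _, affine_R⟩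
    · exact ⟨_, _, affine_T⟩
  | one => exact ⟨1, 0, by rw [affine_one_zero, ofHyp_one]⟩
  | mul x y _ _ hx hy =>
    obtain ⟨z, c, h⟩ := hx
    obtain ⟨z', c', h'⟩ := hy
    exact ⟨_, _, by rw [ofHyp_mul, ← h, ← h', ← toIHom_comp, affine_comp]⟩
  | inv x _ hx =>
    obtain ⟨z, c, h⟩ := hx
    have h₁ : (affine n z (-z * c)).comp (affine n z c) = affine n 1 0 := by
      rw [affine_comp, show z * z = 1 from by rcases Int.units_eq_one_or z with h | h <;> simp [h],
        show (z : ℤ) * c + -z * c = 0 by ring]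
    refine ⟨z, -z * c, ?_⟩
    have h₂ := toIHom_comp (affine n z (-z * c)) (affine n z c)
    rw [h₁, affine_one_zero, h] at h₂
    have h₃ := congrArg (fun f => f.comp (ofHyp x⁻¹)) h₂
    simp only [IHom.comp_assoc, ← ofHyp_mul, mul_inv_cancel, ofHyp_one, IHom.id_comp,
      IHom.comp_id] at h₃
    exact h₃.symm

lemma exists_mem_of_affine (z : ℤˣ) (c : ℤ) :
    ∃ d ∈ dihedral n, (affine n z c).toIHom = ofHyp d := by
  have hT : T n ∈ dihedral n := Subgroup.subset_closure (by simp)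
  have hR : R n ∈ dihedral n := Subgroup.subset_closure (by simp)
  have trans : ∀ c : ℕ, (affine n 1 c).toIHom = ofHyp (T n ^ c) := by
    intro c
    induction c with
    | zero => rw [pow_zero, ofHyp_one, Nat.cast_zero, affine_one_zero]
    | succ i ih =>
      rw [pow_succ, ofHyp_mul, ← ih, ← affine_T, ← toIHom_comp, affine_comp]
      simp [add_comm]
  have trans' : ∀ c : ℤ, ∃ d ∈ dihedral n, (affine n 1 c).toIHom = ofHyp d := by
    intro c
    refine ⟨T n ^ (res n c : ℕ), pow_mem hT _, ?_⟩
    rw [← trans, res_cast]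
    conv_lhs => rw [← Int.emod_add_ediv_mul c (n + 1)]
    exact affine_congr 1 _ _
  rcases Int.units_eq_one_or z with rfl | rfl
  · exact trans' c
  · obtain ⟨d, hd, h⟩ := trans' (c - n)
    refine ⟨d * R n, mul_mem hd hR, ?_⟩
    rw [ofHyp_mul, ← h, ← affine_R, ← toIHom_comp, affine_comp]
    simp

lemma isDihedral_toIHom (F : Lift n m) : IsDihedral F.toIHom := by
  set s := F.dualFun 0 with hs
  have hm : (0 : ℤ) < (m : ℤ) + 1 := by omega
  have hle := F.dualFun_le 0
  -- the base point and orientation from which the word of `F` has to be read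
  obtain ⟨c, hlow, hhigh⟩ : ∃ c : ℤ, (0 ≤ F.toFun c) ∧ F.toFun (F.sign * n + c) ≤ m := by
    rcases Int.units_eq_one_or F.sign with h | h
    · refine ⟨s, ?_, ?_⟩
      · rcases (hle s).1 le_rfl with ⟨-, h'⟩ | ⟨h', -⟩
        · exact h'
        · exact absurd (h.symm.trans h') (by decide)
      · have : ¬ F.Beyond 0 (s - 1) := fun h' => by have := (hle _).2 h'; omega
        have h' : F.toFun (s - 1) < 0 := lt_of_not_ge fun hc => this (Or.inl ⟨h, hc⟩)
        have p := F.period (s - 1)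
        rw [h] at p ⊢
        rw [show ((1 : ℤˣ) : ℤ) * n + s = s - 1 + (n + 1) by push_cast; ring, p]
        push_cast
        omega
    · refine ⟨s - 1, ?_, ?_⟩
      · have : ¬ F.Beyond 0 (s - 1) := fun h' => by have := (hle _).2 h'; omega
        exact le_of_not_gt fun hc => this (Or.inr ⟨h, hc⟩)
      · have h' : F.toFun s < 0 := by
          rcases (hle s).1 le_rfl with ⟨h', -⟩ | ⟨-, h'⟩
          · exact absurd (h.symm.trans h') (by decide)
          · exact h'
        have p := F.period (s - 1 - n)
        rw [h] at p ⊢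
        rw [show ((-1 : ℤˣ) : ℤ) * n + (s - 1) = s - 1 - n by push_cast; ring]
        rw [show s - 1 - (n : ℤ) + (n + 1) = s by ring] at p
        push_cast at p
        omega
  set G := F.comp (affine n F.sign c) with hG
  have hG1 : G.sign = 1 := by
    change F.sign * F.sign = 1
    rcases Int.units_eq_one_or F.sign with h | h <;> simp [h]
  have Gmono : ∀ {x y : ℤ}, x ≤ y → G.toFun x ≤ G.toFun y := fun h => by
    have := G.mono h
    rw [hG1] at this
    simpa using this
  have G0 : 0 ≤ G.toFun 0 := by
    change 0 ≤ F.toFun (F.sign * 0 + c)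
    simpa using hlow
  have Gn : G.toFun n ≤ m := hhigh
  have Gval : ∀ a : Fin (n + 1), ((res m (G.toFun a) : ℕ) : ℤ) = G.toFun a := fun a => by
    rw [res_cast]
    have h₁ := Gmono (show (0 : ℤ) ≤ a by omega)
    have h₂ := Gmono (show ((a : ℕ) : ℤ) ≤ n by have := a.2; omega)
    exact Int.emod_eq_of_lt (by omega) (by omega)
  let φ : Fin (n + 1) →o Fin (m + 1) := ⟨fun a => res m (G.toFun a), fun a b h => by
    rw [Fin.le_def, ← Int.ofNat_le, Gval, Gval]
    exact Gmono (by rw [Fin.le_def] at h; omega)⟩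
  have hφ : ∀ a : Fin (n + 1), (ofMono φ).toFun a = G.toFun a := fun a => by
    rw [ofMono_coe]
    exact Gval a
  have hφ' : ∀ x : ℤ, (ofMono φ).toFun x = G.toFun x := fun x => by
    obtain ⟨k, hk⟩ := res_eq_iff.1 (res_coe (res n x))
    rw [hk, period_mul, period_mul, hφ, hG1]
    rfl
  have hGφ : G.toIHom = InvolutiveNonCommSets.ofMono φ := by
    rw [← toIHom_ofMono]
    exact toIHom_eq_of_add _ _ hG1 0 fun x => by rw [hφ']; ring
  obtain ⟨d, hd, hd'⟩ := exists_mem_of_affine (n := n) F.sign c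
  refine ⟨φ, d⁻¹, inv_mem hd, ?_⟩
  rw [← hGφ, hG, toIHom_comp, hd', IHom.comp_assoc, ← ofHyp_mul, mul_inv_cancel, ofHyp_one,
    IHom.comp_id]

end Lift

lemma isDihedral_iff {n m : ℕ} (f : IHom n m) : IsDihedral f ↔ ∃ F : Lift n m, F.toIHom = f := by
  constructor
  · rintro ⟨φ, d, hd, rfl⟩
    obtain ⟨z, c, h⟩ := Lift.exists_affine_of_mem hd
    exact ⟨(Lift.ofMono φ).comp (Lift.affine n z c), by
      rw [Lift.toIHom_comp, Lift.toIHom_ofMono, h]⟩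
  · rintro ⟨F, rfl⟩
    exact F.isDihedral_toIHom

lemma isDihedral_id (n : ℕ) : IsDihedral (IHom.id n) :=
  (isDihedral_iff _).2 ⟨Lift.affine n 1 0, Lift.affine_one_zero⟩

lemma IsDihedral.comp {n m l : ℕ} {g : IHom m l} {f : IHom n m} (hg : IsDihedral g)
    (hf : IsDihedral f) : IsDihedral (g.comp f) := by
  obtain ⟨G, rfl⟩ := (isDihedral_iff g).1 hg
  obtain ⟨F, rfl⟩ := (isDihedral_iff f).1 hf
  exact (isDihedral_iff _).2 ⟨G.comp F, G.toIHom_comp F⟩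

/-- The morphisms of `𝓘𝓕(as)` which belong to `ΔD`. -/
def dihedralMorphisms : MorphismProperty IFas := fun _ _ f => IsDihedral f

instance : dihedralMorphisms.IsMultiplicative where
  id_mem X := isDihedral_id X.deg
  comp_mem _ _ hf hg := IsDihedral.comp hg hf

/-- The dihedral category `ΔD = Δ ∘ D`. -/
abbrev DeltaD : Type := WideSubcategory dihedralMorphisms

/-- The inclusion `i : ΔD → 𝓘𝓕(as)`. -/
def inclusion : DeltaD ⥤ IFas := wideSubcategoryInclusion dihedralMorphisms

/-! # The dihedral duality -/

/-- The dual of a morphism of `ΔD`: represent it by a periodic map, and take the dual of that. -/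
noncomputable def dualHom {n m : ℕ} (f : IHom n m) (hf : IsDihedral f) : IHom m n :=
  ((isDihedral_iff f).1 hf).choose.dual.toIHom

lemma dualHom_toIHom {n m : ℕ} (F : Lift n m) (h : IsDihedral F.toIHom) :
    dualHom F.toIHom h = F.dual.toIHom :=
  Lift.dual_congr _ _ ((isDihedral_iff F.toIHom).1 h).choose_spec

lemma isDihedral_dualHom {n m : ℕ} (f : IHom n m) (hf : IsDihedral f) :
    IsDihedral (dualHom f hf) :=
  Lift.isDihedral_toIHom _

lemma dualHom_id (n : ℕ) : dualHom (IHom.id n) (isDihedral_id n) = IHom.id n := by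
  have h : ∀ (f : IHom n n) (hf : IsDihedral f), f = (Lift.affine n 1 0).toIHom →
      dualHom f hf = IHom.id n := by
    rintro _ hf rfl
    rw [dualHom_toIHom, ← Lift.affine_one_zero]
    refine Lift.toIHom_eq_of_add _ _ rfl 0 fun x => ?_
    have : x = (Lift.affine n 1 0).dualFun x :=
      Lift.eq_dualFun _ fun i => by simp [Lift.Beyond, Lift.affine]
    change (Lift.affine n 1 0).dualFun x = ((1 : ℤˣ) : ℤ) * x + 0 + 0 * _
    rw [← this]
    simp
  exact h _ _ Lift.affine_one_zero.symm

lemma dualHom_comp {n m l : ℕ} (g : IHom m l) (f : IHom n m) (hg : IsDihedral g)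
    (hf : IsDihedral f) :
    dualHom (g.comp f) (hg.comp hf) = (dualHom f hf).comp (dualHom g hg) := by
  obtain ⟨G, rfl⟩ := (isDihedral_iff g).1 hg
  obtain ⟨F, rfl⟩ := (isDihedral_iff f).1 hf
  have h : ∀ (e : IHom n l) (he : IsDihedral e), e = (G.comp F).toIHom →
      dualHom e he = F.dual.toIHom.comp G.dual.toIHom := by
    rintro _ he rfl
    rw [dualHom_toIHom, ← Lift.toIHom_comp]
    refine Lift.toIHom_eq_of_add _ _ (mul_comm _ _) 0 fun x => ?_
    rw [Lift.dual_comp]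
    ring
  rw [dualHom_toIHom, dualHom_toIHom]
  exact h _ _ (G.toIHom_comp F).symm

/-- The dihedral duality `D : ΔDᵒᵖ → ΔD`.  On generators: the dual of the coface `δ_i : [n-1] → [n]`
is the map merging `i` and `i + 1` if `i < n`, and merging `n` and `0`, in this order, if `i = n`;
the dual of the codegeneracy merging `j` and `j + 1` is the coface omitting `j + 1`; the dual of
`T` is `T⁻¹`, and the dual of `R` is `T ∘ R`. -/
noncomputable def duality : DeltaDᵒᵖ ⥤ DeltaD where
  obj X := X.unop
  map f := ⟨dualHom f.unop.hom f.unop.property, isDihedral_dualHom _ _⟩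
  map_id X := by
    ext : 1
    exact dualHom_id X.unop.obj.deg
  map_comp f g := by
    ext : 1
    exact dualHom_comp f.unop.hom g.unop.hom f.unop.property g.unop.property

/-! # The functor `B` -/

lemma eq_one_of_mem_hypPlus {n : ℕ} {g : Hyp n} (hg : g ∈ dihedral n) (hg' : g ∈ hypPlus n) :
    g = 1 := by
  obtain ⟨z, c, h⟩ := Lift.exists_affine_of_mem hg
  obtain ⟨h₁, h₂⟩ := hg'
  have hz : z = 1 := by
    have : z = g.left (g.right 0) := congrFun (congrArg IHom.label h) 0
    rw [this, h₂, h₁]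
  subst hz
  have hc : res n 0 = res n c := by
    have h₃ := Lift.toIHom_toFun_res (Lift.affine n 1 c) 0
    have h₄ : res n 0 = 0 := res_coe (0 : Fin (n + 1))
    rw [h, h₄] at h₃
    change g.right 0 = res n (((1 : ℤˣ) : ℤ) * 0 + c) at h₃
    rw [h₄, ← h₂, h₃]
    simp
  obtain ⟨k, rfl⟩ := res_eq_iff.1 hc
  rw [Lift.affine_congr, Lift.affine_one_zero, ← ofHyp_one] at h
  exact (ofHyp_injective h).symm

lemma exists_dihedral_mul_hypPlus {n : ℕ} (g : Hyp n) :
    ∃ d ∈ dihedral n, ∃ h ∈ hypPlus n, g = d * h := by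
  -- move the position of `0` back to `0`, and its label back to `1`
  set z := g.left (g.right 0) with hz
  set c : ℤ := ((g.right 0 : ℕ) : ℤ)
  obtain ⟨d, hd, h⟩ := Lift.exists_mem_of_affine (n := n) z c
  refine ⟨d, hd, d⁻¹ * g, ?_, by group⟩
  have hr : d.right 0 = g.right 0 := by
    have h₃ := Lift.toIHom_toFun_res (Lift.affine n z c) 0
    have h₄ : res n 0 = 0 := res_coe (0 : Fin (n + 1))
    rw [h, h₄] at h₃
    change d.right 0 = res n ((z : ℤ) * 0 + c) at h₃
    rw [h₃, mul_zero, zero_add, res_coe]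
  have hl : d.left (g.right 0) = z := by
    rw [← hr]
    exact (congrFun (congrArg IHom.label h) 0).symm
  have e : (ofHyp d).comp (ofHyp (d⁻¹ * g)) = ofHyp g := by
    rw [← ofHyp_mul, mul_inv_cancel_left]
  have e₁ : d.right ((d⁻¹ * g).right 0) = g.right 0 := congrFun (congrArg IHom.toFun e) 0
  have e₂ : d.left (d.right ((d⁻¹ * g).right 0)) * (d⁻¹ * g).left ((d⁻¹ * g).right 0) =
      g.left (g.right 0) := congrFun (congrArg IHom.label e) 0
  have e₃ : (d⁻¹ * g).right 0 = 0 := d.right.injective (e₁.trans hr.symm)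
  refine ⟨?_, e₃⟩
  rw [e₁, hl, ← hz, e₃] at e₂
  simpa using e₂

/-- The decomposition `𝓘𝓕(as) = ΔD ∘ H⁺`: every morphism is uniquely of the form `d ∘ h`, with `d`
in `ΔD` and `h` in `H⁺`. -/
lemma existsUnique_hypPlus {n m : ℕ} (f : IHom n m) :
    ∃! h : hypPlus n, ∃ d : IHom n m, IsDihedral d ∧ f = d.comp (ofHyp h) := by
  obtain ⟨φ, g, rfl⟩ := exists_ofMono_comp_ofHyp f
  obtain ⟨d, hd, h, hh, rfl⟩ := exists_dihedral_mul_hypPlus g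
  refine ⟨⟨h, hh⟩, ⟨(ofMono φ).comp (ofHyp d), ⟨φ, d, hd, rfl⟩, ?_⟩, ?_⟩
  · rw [ofHyp_mul, IHom.comp_assoc]
  · rintro ⟨h', hh'⟩ ⟨_, ⟨φ', d', hd', rfl⟩, e⟩
    rw [IHom.comp_assoc, ← ofHyp_mul] at e
    have e' := (ofMono_comp_ofHyp_injective e).2
    change d * h = d' * h' at e'
    have key : h' * h⁻¹ = 1 := by
      refine eq_one_of_mem_hypPlus ?_ (mul_mem hh' (inv_mem hh))
      have : h' * h⁻¹ = d'⁻¹ * d := by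
        rw [eq_inv_mul_iff_mul_eq, ← mul_assoc, ← e', mul_inv_cancel_right]
      rw [this]
      exact mul_mem (inv_mem hd') hd
    exact Subtype.ext (mul_inv_eq_one.1 key)

/-- The component in `H⁺` of a morphism of `𝓘𝓕(as)`. -/
noncomputable def hypPlusPart {n m : ℕ} (f : IHom n m) : hypPlus n :=
  (existsUnique_hypPlus f).choose

lemma hypPlusPart_spec {n m : ℕ} (f : IHom n m) :
    ∃ d : IHom n m, IsDihedral d ∧ f = d.comp (ofHyp (hypPlusPart f)) :=
  (existsUnique_hypPlus f).choose_spec.1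

lemma eq_hypPlusPart {n m : ℕ} (h : hypPlus n) (d : IHom n m) (hd : IsDihedral d) :
    hypPlusPart (d.comp (ofHyp h)) = h :=
  ((existsUnique_hypPlus (d.comp (ofHyp h))).unique (hypPlusPart_spec _) ⟨d, hd, rfl⟩)

lemma hypPlusPart_comp {n m l : ℕ} (g : IHom m l) (f : IHom n m) :
    hypPlusPart (g.comp f) = hypPlusPart ((ofHyp (hypPlusPart g)).comp f) := by
  obtain ⟨d, hd, e⟩ := hypPlusPart_spec g
  obtain ⟨d', hd', e'⟩ := hypPlusPart_spec ((ofHyp (hypPlusPart g : Hyp m)).comp f)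
  have : g.comp f = (d.comp d').comp (ofHyp (hypPlusPart ((ofHyp (hypPlusPart g)).comp f))) := by
    rw [IHom.comp_assoc, ← e', ← IHom.comp_assoc, ← e]
  rw [this, eq_hypPlusPart _ _ (hd.comp hd')]

/-- The right action of `𝓘𝓕(as)` on `H⁺` by pre-composition: `h · f` is the component in `H⁺` of
the composite `h ∘ f`. -/
noncomputable def precomp {n m : ℕ} (f : IHom n m) (h : hypPlus m) : hypPlus n :=
  hypPlusPart ((ofHyp h).comp f)

lemma precomp_id {n : ℕ} (h : hypPlus n) : precomp (IHom.id n) h = h := by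
  have := eq_hypPlusPart h _ (isDihedral_id n)
  rw [IHom.id_comp] at this
  rw [precomp, IHom.comp_id, this]

lemma precomp_comp {n m l : ℕ} (g : IHom m l) (f : IHom n m) (h : hypPlus l) :
    precomp (g.comp f) h = precomp f (precomp g h) := by
  rw [precomp, precomp, precomp, ← IHom.comp_assoc, hypPlusPart_comp]

/-- The functor `B : 𝓘𝓕(as)ᵒᵖ → Mod_k`.  Since the groupoid `H⁺` has no morphisms between distinct
objects, `B([n])` is the free module on `Hom_{H⁺}([n], [n]) = H⁺_{n+1}`. -/
noncomputable def B (k : Type u) [CommRing k] : IFasᵒᵖ ⥤ ModuleCat.{u} k where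
  obj X := ModuleCat.of k (hypPlus X.unop.deg →₀ k)
  map f := ModuleCat.ofHom (Finsupp.lmapDomain k k (precomp f.unop))
  map_id X := by
    ext : 1
    refine Finsupp.lhom_ext' fun h => LinearMap.ext_ring ?_
    have : precomp (𝟙 X.unop : X.unop ⟶ X.unop) h = h := precomp_id h
    simp [Finsupp.mapDomain_single, this]
  map_comp f g := by
    ext : 1
    refine Finsupp.lhom_ext' fun h => LinearMap.ext_ring ?_
    have : precomp (g.unop ≫ f.unop) h = precomp g.unop (precomp f.unop h) := precomp_comp _ _ h
    simp [Finsupp.mapDomain_single, this]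

/-- The functor `B` on `ΔH`, through the isomorphism `ΔH ≅ 𝓘𝓕(as)`. -/
noncomputable def deltaHB (k : Type u) [CommRing k] : DeltaHᵒᵖ ⥤ ModuleCat.{u} k :=
  deltaHToIFas.op ⋙ B k

/-- Dihedral homology `HD_⋆(F)` of `F : ΔDᵒᵖ → Mod_k`. -/
noncomputable def dihedralHomology {k : Type u} [CommRing k] (F : DeltaDᵒᵖ ⥤ ModuleCat.{u} k) :
    GradedObject ℕ (ModuleCat.{u} k) :=
  FunctorHomology.Tor (FunctorHomology.constFunctor DeltaDᵒᵖᵒᵖ k) F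

end InvolutiveNonCommSets

/-! Both isomorphisms are instances of one change-of-categories principle. Let `i : C ⥤ D` be such
that every functor `c ↦ Hom(d, i(c))` is a disjoint union of representables `Hom(c_s, -)`, the
inclusion of the `s`-th one being given by a unit `d ⟶ i(c_s)`. Then the restriction along `i` of a
free functor on `D` is a direct sum of free functors on `C`. Restriction is also exact, so it
carries projective resolutions to projective resolutions.

On the other side, the left Kan extension along `i.op` of a right `C`-module `G` has the value `⨁
G(c_s)` at `d`. If `G'` is this extension (`IsInduced`), then `G ⊗_C (F ∘ i) ≅ G' ⊗_D F`, naturally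
in `F` (`tensorIso`). Applying this to the terms of a projective resolution of `F` gives `Tor^C(G, F
∘ i) ≅ Tor^D(G', F)` (`nonempty_tor_iso`).

For dihedral homology, `i` is the duality followed by the inclusion of `ΔD`. The duality is fully
faithful because its square is conjugation by `T`, so the unique factorization `d ∘ h` says
precisely that the elements `h` of `H⁺` are the units of a universal family (`hypPlusFamily`). The
extension of the constant functor therefore has one copy of `k` for each element of `H⁺`, and it is
`B` (`isInduced_constToB`). For `ΔH`, the functor `i` is an isomorphism of categories, and each
family has a single member, the identity. -/

namespace FunctorHomology

open CategoryTheory CategoryTheory.Limits Opposite MonoidalCategory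

variable {C D : Type} [SmallCategory C] [SmallCategory D] {k : Type u} [CommRing k]

/-! ### Left multiadjoints and the restriction of projective functors. -/

/-- A family of morphisms `d ⟶ i(c_s)`, for each `d : D`, through exactly one of which every
morphism `d ⟶ i(c)` factors, in a unique way: a left multiadjoint of `i`. -/
structure UniversalFamily (i : C ⥤ D) where
  Idx : D → Type
  obj : ∀ d, Idx d → C
  unit : ∀ d (s : Idx d), d ⟶ i.obj (obj d s)
  bijective : ∀ (d : D) (c : C), Function.Bijective
    fun x : Σ s : Idx d, (obj d s ⟶ c) => unit d x.1 ≫ i.map x.2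

namespace UniversalFamily

variable {i : C ⥤ D} (U : UniversalFamily i)

lemma exists_fac {d : D} {c : C} (g : d ⟶ i.obj c) :
    ∃ (s : U.Idx d) (f : U.obj d s ⟶ c), g = U.unit d s ≫ i.map f := by
  obtain ⟨⟨s, f⟩, h⟩ := (U.bijective d c).2 g
  exact ⟨s, f, h.symm⟩

/-- The factorization of a morphism `d ⟶ i(c)`. -/
noncomputable def fac {d : D} {c : C} (g : d ⟶ i.obj c) : Σ s : U.Idx d, (U.obj d s ⟶ c) :=
  (Equiv.ofBijective _ (U.bijective d c)).symm g

lemma fac_unit_comp {d : D} {c : C} (s : U.Idx d) (f : U.obj d s ⟶ c) :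
    U.fac (U.unit d s ≫ i.map f) = ⟨s, f⟩ :=
  (Equiv.ofBijective _ (U.bijective d c)).symm_apply_apply ⟨s, f⟩

/-- The restriction of `freeCover F` along `i` is a sum of representable functors. -/
lemma projective_freeCover (U : UniversalFamily i) (F : D ⥤ ModuleCat.{u} k) : Projective (i ⋙ freeCover F) where
  factors {E X} f e he := by
    have hs : ∀ c, Function.Surjective (e.app c).hom := fun c =>
      (ModuleCat.epi_iff_surjective _).1 inferInstance
    -- Lifts are chosen only over the generators attached to the units. These generate the
    -- restricted functor freely, so the choices need not satisfy any compatibility.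
    choose σ hσ using fun (d : D) (s : U.Idx d) (x : F.obj d) =>
      hs (U.obj d s) ((f.app (U.obj d s)).hom (freeCoverGen F (U.unit d s) x))
    -- A generator indexed by `g : d ⟶ i.obj c` is sent to the chosen lift at the unit through which
    -- `g` factors, transported along the second factor of `g`.
    let φ (c : C) : (freeCover F).obj (i.obj c) ⟶ E.obj c :=
      ModuleCat.ofHom (Finsupp.linearCombination k
        fun q : (Σ d : D, (d ⟶ i.obj c) × F.obj d) =>
          (E.map (U.fac q.2.1).2).hom (σ q.1 (U.fac q.2.1).1 q.2.2))
    have hφ : ∀ {d : D} {c : C} (s : U.Idx d) (g : U.obj d s ⟶ c) (x : F.obj d),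
        (φ c).hom (freeCoverGen F (U.unit d s ≫ i.map g) x) = (E.map g).hom (σ d s x) := by
      intro d c s g x
      refine (Finsupp.linearCombination_single k 1 _).trans ((one_smul k _).trans ?_)
      simp only
      rw [U.fac_unit_comp]
    refine ⟨⟨φ, fun c c' h => freeCover_linear_ext fun d g x => ?_⟩, ?_⟩
    -- Naturality: composing with `i.map h` changes only the second factor and leaves the index `s`
    -- alone.
    · obtain ⟨s, g, rfl⟩ := U.exists_fac g
      rw [ModuleCat.hom_comp, ModuleCat.hom_comp, LinearMap.comp_apply, LinearMap.comp_apply, hφ,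
        Functor.comp_map, freeCover_map_gen, Category.assoc, ← i.map_comp, hφ, E.map_comp]
      rfl
    · ext c : 2
      refine freeCover_linear_ext fun d g x => ?_
      obtain ⟨s, g, rfl⟩ := U.exists_fac g
      -- Naturality of `e` and of `f` along `g` reduces the claim to the unit, where `σ` lifts by
      -- choice.
      have h₁ := congrArg (fun t => t.hom (σ d s x)) (e.naturality g)
      have h₂ := congrArg (fun t => t.hom (freeCoverGen F (U.unit d s) x)) (f.naturality g)
      simp only [ModuleCat.hom_comp, LinearMap.comp_apply, hσ, Functor.comp_map] at h₁ h₂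
      have h₃ := freeCover_map_gen F (U.unit d s) (i.map g) x
      rw [h₃] at h₂
      rw [NatTrans.comp_app, ModuleCat.hom_comp, LinearMap.comp_apply, h₂, ← h₁]
      exact congrArg _ (hφ s g x)

/-- A projective functor is a retract of its free cover, and restriction along `i` preserves
retracts; so the case of free covers suffices. -/
lemma preservesProjectiveObjects (U : UniversalFamily i) :
    ((Functor.whiskeringLeft C D (ModuleCat.{u} k)).obj i).PreservesProjectiveObjects where
  projective_obj {P} hP := by
    have := U.projective_freeCover P
    have hs : ∀ d, Function.Surjective ((freeCoverDesc P P fun _ x => x).app d).hom := fun d x =>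
      ⟨freeCoverGen P (𝟙 d) x, by simpa using freeCoverDesc_gen P P (fun _ x => x) (𝟙 d) x⟩
    have : ∀ d, Epi ((freeCoverDesc P P fun _ x => x).app d) := fun d =>
      (ModuleCat.epi_iff_surjective _).2 (hs d)
    have : Epi (freeCoverDesc P P fun _ x => x) := NatTrans.epi_of_epi_app _
    let s := Projective.factorThru (𝟙 P) (freeCoverDesc P P fun _ x => x)
    have h : s ≫ freeCoverDesc P P (fun _ x => x) = 𝟙 P := Projective.factorThru_comp _ _
    refine Retract.projective (Y := i ⋙ freeCover P) (X := i ⋙ P) ⟨Functor.whiskerLeft i s,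
      Functor.whiskerLeft i (freeCoverDesc P P fun _ x => x), ?_⟩
    rw [← Functor.whiskerLeft_comp, h]
    rfl

end UniversalFamily

/-! ### Tensor products with an induced right module. -/

/-- The universal property of a direct sum is preserved by tensor products. -/
lemma existsUnique_whiskerRight {S : Type} {A : S → ModuleCat.{u} k} {X : ModuleCat.{u} k}
    (a : ∀ s, A s ⟶ X)
    (h : ∀ (M : ModuleCat.{u} k) (f : ∀ s, A s ⟶ M), ∃! g : X ⟶ M, ∀ s, a s ≫ g = f s)
    (N M : ModuleCat.{u} k) (f : ∀ s, A s ⊗ N ⟶ M) :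
    ∃! g : X ⊗ N ⟶ M, ∀ s, a s ▷ N ≫ g = f s := by
  -- Tensor-hom adjunction: maps out of `A s ⊗ N` into `M` are maps out of `A s` into the linear
  -- maps `N → M`, to which the hypothesis applies.
  obtain ⟨g, hg, hu⟩ := h (ModuleCat.of k (N →ₗ[k] M))
    fun s => ModuleCat.ofHom (TensorProduct.curry (f s).hom)
  refine ⟨ModuleCat.ofHom (TensorProduct.lift g.hom), fun s => ?_, fun g' hg' => ?_⟩
  · ext : 1
    refine TensorProduct.ext' fun x y => ?_
    exact congrArg (fun t : A s ⟶ ModuleCat.of k (N →ₗ[k] M) => t.hom x y) (hg s)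
  · have := hu (ModuleCat.ofHom (TensorProduct.curry g'.hom)) fun s => by
      ext x y
      exact congrArg (fun t : A s ⊗ N ⟶ M => t.hom (x ⊗ₜ y)) (hg' s)
    subst this
    ext : 1
    exact TensorProduct.ext' fun x y => rfl

section Comparison

variable {i : C ⥤ D} (U : UniversalFamily i) {G : Cᵒᵖ ⥤ ModuleCat.{u} k}
  {G' : Dᵒᵖ ⥤ ModuleCat.{u} k} (α : G ⟶ i.op ⋙ G')

/-- `α` exhibits each `G'(d)` as the direct sum of the modules `G(c_s)`, where `d ⟶ i(c_s)` is the
universal family. -/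
def UniversalFamily.IsInduced : Prop :=
  ∀ (d : D) (M : ModuleCat.{u} k) (f : ∀ s : U.Idx d, G.obj (op (U.obj d s)) ⟶ M),
    ∃! g : G'.obj (op d) ⟶ M, ∀ s, (α.app (op (U.obj d s)) ≫ G'.map (U.unit d s).op) ≫ g = f s

/-- The inclusion of `G(c) ⊗ F(c)` into `G ⊗_C F`. -/
noncomputable def tensorι (G : Cᵒᵖ ⥤ ModuleCat.{u} k) (F : C ⥤ ModuleCat.{u} k) (c : C) :
    G.obj (op c) ⊗ F.obj c ⟶ (tensorFunctor G).obj F :=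
  coend.ι ((tensorBifunctor G).obj F) c

lemma tensorι_condition (G : Cᵒᵖ ⥤ ModuleCat.{u} k) (F : C ⥤ ModuleCat.{u} k) {c c' : C}
    (f : c ⟶ c') :
    G.map f.op ▷ F.obj c ≫ tensorι G F c = G.obj (op c') ◁ F.map f ≫ tensorι G F c' :=
  coend.condition ((tensorBifunctor G).obj F) f

lemma tensor_hom_ext {F : C ⥤ ModuleCat.{u} k} {M : ModuleCat.{u} k}
    {a b : (tensorFunctor G).obj F ⟶ M} (h : ∀ c, tensorι G F c ≫ a = tensorι G F c ≫ b) : a = b :=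
  coend.hom_ext h

lemma tensor_exists_desc {F : C ⥤ ModuleCat.{u} k} {M : ModuleCat.{u} k}
    (a : ∀ c, G.obj (op c) ⊗ F.obj c ⟶ M)
    (h : ∀ ⦃c c' : C⦄ (f : c ⟶ c'), G.map f.op ▷ F.obj c ≫ a c = G.obj (op c') ◁ F.map f ≫ a c') :
    ∃ b : (tensorFunctor G).obj F ⟶ M, ∀ c, tensorι G F c ≫ b = a c :=
  ⟨coend.desc (F := (tensorBifunctor G).obj F) a h, fun c =>
    coend.ι_desc (F := (tensorBifunctor G).obj F) a h c⟩

lemma tensorι_map (G : Cᵒᵖ ⥤ ModuleCat.{u} k) {F F' : C ⥤ ModuleCat.{u} k} (β : F ⟶ F') (c : C) :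
    tensorι G F c ≫ (tensorFunctor G).map β = G.obj (op c) ◁ β.app c ≫ tensorι G F' c :=
  coend.ι_map _ c

lemma exists_tensorComparison (F : D ⥤ ModuleCat.{u} k) :
    ∃ φ : (tensorFunctor G).obj (i ⋙ F) ⟶ (tensorFunctor G').obj F,
      ∀ c, tensorι G (i ⋙ F) c ≫ φ = α.app (op c) ▷ F.obj (i.obj c) ≫ tensorι G' F (i.obj c) := by
  refine tensor_exists_desc (F := i ⋙ F) _ fun c c' f => ?_
  have h₁ := α.naturality f.op
  have h₂ := tensorι_condition G' F (i.map f)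
  simp only [Functor.comp_map, Functor.op_map, Quiver.Hom.unop_op] at h₁
  simp only [Functor.comp_obj, Functor.comp_map]
  -- Naturality of `α` replaces `G(f)` by `G'(i(f))`; what remains is the coend relation of `G' ⊗_D
  -- F` at `i(f)`.
  rw [← comp_whiskerRight_assoc, h₁, comp_whiskerRight_assoc, whisker_exchange_assoc]
  exact congrArg _ h₂

/-- The map `G ⊗_C (F ∘ i) ⟶ G' ⊗_D F` induced by `α`. -/
noncomputable def tensorComparison (F : D ⥤ ModuleCat.{u} k) :
    (tensorFunctor G).obj (i ⋙ F) ⟶ (tensorFunctor G').obj F :=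
  (exists_tensorComparison α F).choose

lemma tensorι_comparison (F : D ⥤ ModuleCat.{u} k) (c : C) :
    tensorι G (i ⋙ F) c ≫ tensorComparison α F =
      α.app (op c) ▷ F.obj (i.obj c) ≫ tensorι G' F (i.obj c) :=
  (exists_tensorComparison α F).choose_spec c

variable {U α}

/-- The inverse is built on the summands `G(c_s)` of `G'(d)`: on `G(c_s) ⊗ F(d)`, push the second
factor forward along the unit `d ⟶ i(c_s)`, which lands in `G(c_s) ⊗ F(i(c_s))`. -/
lemma UniversalFamily.IsInduced.isIso_tensorComparison (hα : U.IsInduced α)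
    (F : D ⥤ ModuleCat.{u} k) : IsIso (tensorComparison α F) := by
  have key := fun d => existsUnique_whiskerRight
    (fun s => α.app (op (U.obj d s)) ≫ G'.map (U.unit d s).op) (hα d)
  -- The inclusions of the summands remain jointly epimorphic after tensoring, so maps out of `G'(d)
  -- ⊗ N` can be compared on each summand.
  have ext : ∀ d {N M : ModuleCat.{u} k} {a b : G'.obj (op d) ⊗ N ⟶ M},
      (∀ s, (α.app (op (U.obj d s)) ≫ G'.map (U.unit d s).op) ▷ N ≫ a =
        (α.app (op (U.obj d s)) ≫ G'.map (U.unit d s).op) ▷ N ≫ b) → a = b :=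
    fun d N M a b h => (key d N M _).unique h fun _ => rfl
  choose ψ hψ _ using fun d => key d (F.obj d) _ fun s =>
    G.obj (op (U.obj d s)) ◁ F.map (U.unit d s) ≫ tensorι G (i ⋙ F) (U.obj d s)
  -- the value of `ψ` on the component of a morphism `d ⟶ i(c)`
  have hψ' : ∀ {d : D} {c : C} (g : d ⟶ i.obj c),
      (α.app (op c) ≫ G'.map g.op) ▷ F.obj d ≫ ψ d =
        G.obj (op c) ◁ F.map g ≫ tensorι G (i ⋙ F) c := by
    intro d c g
    obtain ⟨s, f, rfl⟩ := U.exists_fac g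
    have h₁ := α.naturality f.op
    have h₂ := tensorι_condition G (i ⋙ F) f
    simp only [Functor.comp_map, Functor.op_map, Quiver.Hom.unop_op] at h₁ h₂
    -- With `g` factored as the unit followed by `i(f)`, naturality of `α` moves `f` onto `G`, and
    -- the coend relation of `G ⊗_C (F ∘ i)` then moves it onto `F`.
    rw [op_comp, G'.map_comp, ← Category.assoc, ← h₁, Category.assoc, comp_whiskerRight,
      Category.assoc, hψ, ← whisker_exchange_assoc]
    rw [F.map_comp, MonoidalCategory.whiskerLeft_comp, Category.assoc]
    exact congrArg _ h₂
  -- For `h : d ⟶ d'`, the composite of `h` with a unit at `d'` is in general not a unit at `d`.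
  -- This is why `hψ'` covers all morphisms into the image of `i`.
  obtain ⟨χ, hχ⟩ := tensor_exists_desc (G := G') (F := F) ψ fun d d' h => by
    refine ext d' fun s => ?_
    rw [← comp_whiskerRight_assoc, Category.assoc, ← G'.map_comp, ← op_comp, hψ', F.map_comp,
      ← whisker_exchange_assoc, hψ, MonoidalCategory.whiskerLeft_comp, Category.assoc]
  refine ⟨χ, tensor_hom_ext fun c => ?_, tensor_hom_ext fun d => ?_⟩
  · rw [reassoc_of% tensorι_comparison α F c, hχ, Category.comp_id]
    -- The identity of `i(c)` need not be a unit of the family either; its component of `ψ` is again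
    -- supplied by `hψ'`.
    have := hψ' (𝟙 (i.obj c))
    simpa using this
  · rw [← Category.assoc, hχ, Category.comp_id]
    -- On the `s`-th summand the composite with the comparison reduces to the coend relation of `G'
    -- ⊗_D F` at the unit.
    refine ext d fun s => ?_
    rw [← Category.assoc, hψ, Category.assoc, tensorι_comparison, whisker_exchange_assoc,
      comp_whiskerRight_assoc, tensorι_condition]

/-- If `α` exhibits `G'` as induced from `G`, then `G' ⊗_D F` is isomorphic to
`G ⊗_C (F ∘ i)`. -/
noncomputable def UniversalFamily.IsInduced.tensorIso (hα : U.IsInduced α) :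
    (Functor.whiskeringLeft C D (ModuleCat.{u} k)).obj i ⋙ tensorFunctor G ≅ tensorFunctor G' :=
  have := hα.isIso_tensorComparison
  NatIso.ofComponents (fun F => asIso (tensorComparison α F)) fun {F F'} β => by
    refine tensor_hom_ext fun c => ?_
    change tensorι G (i ⋙ F) c ≫ (tensorFunctor G).map (Functor.whiskerLeft i β) ≫
      tensorComparison α F' = tensorι G (i ⋙ F) c ≫ tensorComparison α F ≫ _
    rw [reassoc_of% tensorι_map G (Functor.whiskerLeft i β) c, tensorι_comparison,
      reassoc_of% tensorι_comparison α F c, tensorι_map]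
    exact whisker_exchange_assoc (α.app (op c)) (β.app (i.obj c)) (tensorι G' F' (i.obj c))

/-! ### Comparison of Tor. -/

/-- If `i` has a universal family, and `G'` is induced from `G`, then
`Tor^C(G, F ∘ i) ≅ Tor^D(G', F)`. -/
theorem UniversalFamily.IsInduced.nonempty_tor_iso (hα : U.IsInduced α)
    (F : D ⥤ ModuleCat.{u} k) : Nonempty (Tor G (i ⋙ F) ≅ Tor G' F) := by
  let W := (Functor.whiskeringLeft C D (ModuleCat.{u} k)).obj i
  have := U.preservesProjectiveObjects (k := k)
  let P := ProjectiveResolution.of F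
  -- Restriction along `i` is exact and preserves projectives, so restricting the terms of `P`
  -- yields a projective resolution of `i ⋙ F`.
  let Q := W.mapProjectiveResolution P
  refine ⟨GradedObject.isoMk _ _ fun n => ?_⟩
  refine Q.isoLeftDerivedObj (tensorFunctor G) n ≪≫ ?_ ≪≫
    (P.isoLeftDerivedObj (tensorFunctor G') n).symm
  -- `tensorIso` is natural in `F`, hence gives an isomorphism of complexes, not only of their
  -- terms.
  exact (HomologicalComplex.homologyFunctor _ _ n).mapIso
    ((NatIso.mapHomologicalComplex hα.tensorIso _).app P.complex)

end Comparison

end FunctorHomology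

namespace InvolutiveNonCommSets

open CategoryTheory Opposite FunctorHomology

/-! ### The dihedral duality is fully faithful. -/

namespace Lift

variable {n m : ℕ}

/-- The dual is defined by an adjunction-like condition on `≤`, and dualizing twice involves its
negation. Since `x ≤ F.dualFun y` is the negation of `F.dualFun y ≤ x - 1`, it means `F(x - 1) < y`
for monotone `F`; the two unit shifts come from converting between strict and weak inequalities. -/
lemma dualFun_dual (F : Lift n m) (x : ℤ) : F.dual.dualFun x = F.toFun (x - 1) + 1 := by
  symm
  refine F.dual.eq_dualFun fun y => ?_
  have h := F.dualFun_le y (x - 1)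
  change _ ↔ (F.sign = 1 ∧ x ≤ F.dualFun y) ∨ (F.sign = -1 ∧ F.dualFun y < x)
  rw [Beyond] at h
  rcases Int.units_eq_one_or F.sign with s | s <;> simp [s] at h ⊢ <;> omega

lemma affine_comp_affine_neg (n : ℕ) (c : ℤ) :
    (affine n 1 c).toIHom.comp (affine n 1 (-c)).toIHom = IHom.id n := by
  rw [← toIHom_comp, affine_comp, ← affine_one_zero]
  simp

lemma affine_neg_comp_affine (n : ℕ) (c : ℤ) :
    (affine n 1 (-c)).toIHom.comp (affine n 1 c).toIHom = IHom.id n := by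
  simpa using affine_comp_affine_neg n (-c)

/-- The double dual is conjugation by the cyclic permutation `T`. -/
lemma toIHom_dual_dual (F : Lift n m) :
    F.dual.dual.toIHom =
      ((affine m 1 1).toIHom.comp F.toIHom).comp (affine n 1 (-1)).toIHom := by
  rw [← toIHom_comp, ← toIHom_comp]
  refine toIHom_eq_of_add _ _ (by simp [comp, affine, dual]) 0 fun x => ?_
  change F.dual.dualFun x = 1 * F.toFun (1 * x + -1) + 1 + _
  rw [dualFun_dual]
  ring_nf

end Lift

/-- Equal duals have equal double duals, and the double dual is conjugation by `T`, which can be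
undone. -/
lemma dualHom_injective {n m : ℕ} {f g : IHom n m} (hf : IsDihedral f) (hg : IsDihedral g)
    (h : dualHom f hf = dualHom g hg) : f = g := by
  obtain ⟨F, rfl⟩ := (isDihedral_iff f).1 hf
  obtain ⟨G, rfl⟩ := (isDihedral_iff g).1 hg
  rw [dualHom_toIHom, dualHom_toIHom] at h
  have h := Lift.dual_congr _ _ h
  rw [Lift.toIHom_dual_dual, Lift.toIHom_dual_dual] at h
  have key : ∀ e : IHom n m, (Lift.affine m 1 (-1)).toIHom.comp
      ((((Lift.affine m 1 1).toIHom.comp e).comp (Lift.affine n 1 (-1)).toIHom).comp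
        (Lift.affine n 1 1).toIHom) = e := fun e => by
    rw [IHom.comp_assoc, Lift.affine_neg_comp_affine, IHom.comp_id, ← IHom.comp_assoc,
      Lift.affine_neg_comp_affine, IHom.id_comp]
  rw [← key F.toIHom, h, key]

lemma exists_dualHom_eq {n m : ℕ} {f : IHom n m} (hf : IsDihedral f) :
    ∃ (g : IHom m n) (hg : IsDihedral g), dualHom g hg = f := by
  obtain ⟨F, rfl⟩ := (isDihedral_iff f).1 hf
  -- `E` is `F` conjugated by `T⁻¹`, so that the double dual of `E` is `F` and the dual of `E` is
  -- the required preimage.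
  let E := ((Lift.affine m 1 (-1)).comp F).comp (Lift.affine n 1 1)
  refine ⟨E.dual.toIHom, Lift.isDihedral_toIHom _, ?_⟩
  rw [dualHom_toIHom, Lift.toIHom_dual_dual, Lift.toIHom_comp, Lift.toIHom_comp,
    ← IHom.comp_assoc, ← IHom.comp_assoc, Lift.affine_comp_affine_neg, IHom.id_comp,
    IHom.comp_assoc, Lift.affine_comp_affine_neg, IHom.comp_id]

instance : duality.Faithful where
  map_injective {X Y f g} h := by
    have h := dualHom_injective f.unop.property g.unop.property (congrArg (·.hom) h)
    exact Quiver.Hom.unop_inj (InducedWideCategory.Hom.ext h)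

instance : duality.Full where
  map_surjective {X Y} f := by
    obtain ⟨g, hg, h⟩ := exists_dualHom_eq f.property
    exact ⟨Quiver.Hom.op ⟨g, hg⟩, InducedWideCategory.Hom.ext h⟩

lemma comp_ofHyp_injective {n m : ℕ} (h : Hyp n) :
    Function.Injective fun f : IHom n m => f.comp (ofHyp h) := by
  refine Function.LeftInverse.injective (g := fun f => f.comp (ofHyp h⁻¹)) fun f => ?_
  simp only
  rw [IHom.comp_assoc, ← ofHyp_mul, mul_inv_cancel, ofHyp_one, IHom.comp_id]

/-! ### The functor `B` is induced from the constant functor on `ΔDᵒᵖ`. -/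

/-- The factorization `𝓘𝓕(as) = ΔD ∘ H⁺`, as a universal family for `ΔDᵒᵖ ≅ ΔD → 𝓘𝓕(as)`. -/
noncomputable def hypPlusFamily : UniversalFamily (duality ⋙ inclusion) where
  Idx X := hypPlus X.deg
  obj X _ := op ⟨X⟩
  unit X h := ofHyp h.1
  bijective X Y := by
    constructor
    · rintro ⟨h, f⟩ ⟨h', f'⟩ e
      change (duality.map f).hom.comp (ofHyp h.1) = (duality.map f').hom.comp (ofHyp h'.1) at e
      -- The index is recovered as the `H⁺`-component of the composite. Then `h`, being invertible,
      -- cancels on the right, and faithfulness of the duality gives `f = f'`.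
      obtain rfl : h = h' := (eq_hypPlusPart h _ (duality.map f).property).symm.trans
        ((congrArg hypPlusPart e).trans (eq_hypPlusPart h' _ (duality.map f').property))
      rw [duality.map_injective (InducedWideCategory.Hom.ext (comp_ofHyp_injective h.1 e))]
    · intro g
      obtain ⟨d, hd, e⟩ := hypPlusPart_spec g
      obtain ⟨f, hf⟩ := duality.map_surjective (X := op (⟨X⟩ : DeltaD)) (Y := Y) ⟨d, hd⟩
      refine ⟨⟨hypPlusPart g, f⟩, ?_⟩
      change (duality.map f).hom.comp _ = g
      rw [hf]
      exact e.symm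

/-- A morphism of `ΔD` has trivial `H⁺`-component. This is the naturality of `constToB`: the basis
vector `1` is invariant under `ΔD`. -/
lemma precomp_one_of_isDihedral {n m : ℕ} {f : IHom n m} (hf : IsDihedral f) :
    precomp f 1 = 1 := by
  have h := eq_hypPlusPart 1 f hf
  rw [OneMemClass.coe_one, ofHyp_one, IHom.comp_id] at h
  rw [precomp, OneMemClass.coe_one, ofHyp_one, IHom.id_comp, h]

/-- Acting by the unit `h` moves the basis vector `1` to `h`, so the units sweep out the whole basis
of `B`. -/
lemma precomp_ofHyp_one {n : ℕ} (h : hypPlus n) : precomp (ofHyp h.1) 1 = h := by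
  rw [precomp, OneMemClass.coe_one, ofHyp_one]
  exact eq_hypPlusPart h _ (isDihedral_id n)

variable (k : Type u) [CommRing k]

lemma B_map_single {X Y : IFasᵒᵖ} (f : X ⟶ Y) (h : hypPlus X.unop.deg) (a : k) :
    ((B k).map f).hom (Finsupp.single h a) = Finsupp.single (precomp f.unop h) a :=
  Finsupp.mapDomain_single

/-- The inclusion of `k^*` into the restriction of `B` to `ΔD`, given by the unit of `H⁺`. -/
noncomputable def constToB :
    constFunctor DeltaDᵒᵖᵒᵖ k ⟶ (duality ⋙ inclusion).op ⋙ B k where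
  app X := ModuleCat.ofHom (Finsupp.lsingle (1 : hypPlus X.unop.unop.obj.deg))
  naturality X Y f := by
    ext : 1
    refine LinearMap.ext_ring ?_
    have h := B_map_single k ((duality ⋙ inclusion).op.map f) 1 1
    have h' : precomp ((duality ⋙ inclusion).op.map f).unop 1 = 1 :=
      precomp_one_of_isDihedral (duality.map f.unop).property
    rw [h'] at h
    exact h.symm

/-- The `s`-th structure map `k ⟶ k[H⁺]` sends `1` to the basis vector `s`, so the condition is the
universal property of the free module on `H⁺`. -/
lemma isInduced_constToB : hypPlusFamily.IsInduced (constToB k) := by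
  intro X M f
  have key : ∀ (s : hypPlus X.deg) (g : (B k).obj (op X) ⟶ M),
      (((constToB k).app (op (hypPlusFamily.obj X s)) ≫
        (B k).map (hypPlusFamily.unit X s).op) ≫ g).hom (1 : k) = g.hom (Finsupp.single s 1) := by
    intro s g
    have h := B_map_single k (hypPlusFamily.unit X s).op 1 1
    have h' : precomp (hypPlusFamily.unit X s) 1 = s := precomp_ofHyp_one s
    exact congrArg g.hom (h.trans (congrArg (fun t => Finsupp.single t (1 : k)) h'))
  refine ⟨ModuleCat.ofHom (Finsupp.linearCombination k
    fun s : hypPlus X.deg => (f s).hom (1 : k)), fun s => ?_, fun g hg => ?_⟩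
  · ext : 1
    refine LinearMap.ext_ring ((key s _).trans ?_)
    exact (Finsupp.linearCombination_single k 1 s).trans (one_smul k ((f s).hom (1 : k)))
  · ext : 1
    refine Finsupp.lhom_ext' fun s => LinearMap.ext_ring ?_
    refine ((key s g).symm.trans (congrArg (fun t => t.hom (1 : k)) (hg s))).trans ?_
    exact ((Finsupp.linearCombination_single k 1 s).trans (one_smul k ((f s).hom (1 : k)))).symm

/-! ### Transport along `ΔH ≅ 𝓘𝓕(as)`. -/

/-- The isomorphism `ΔH ≅ 𝓘𝓕(as)`, as a universal family. -/
noncomputable def deltaHFamily : UniversalFamily deltaHToIFas where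
  Idx _ := Unit
  obj X _ := ⟨X.deg⟩
  unit X _ := 𝟙 X
  bijective X Y := by
    constructor
    · rintro ⟨⟨⟩, f⟩ ⟨⟨⟩, f'⟩ e
      have e : f.toIHom.comp (IHom.id _) = f'.toIHom.comp (IHom.id _) := e
      rw [IHom.comp_id, IHom.comp_id] at e
      rw [DeltaHHom.toIHom_injective e]
    · intro g
      -- Fullness is the existence of the decomposition `φ ∘ g`; its uniqueness gave faithfulness
      -- above.
      obtain ⟨φ, h, e⟩ := exists_ofMono_comp_ofHyp g
      exact ⟨⟨(), ⟨φ, h⟩⟩, (Category.id_comp _).trans e.symm⟩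

/-- There is one index, and the unit and the comparison map are both identities, so the direct sum
has a single summand, the module itself. -/
lemma isInduced_id_deltaHB : deltaHFamily.IsInduced (𝟙 (deltaHB k)) := by
  intro X M f
  have h : (B k).map (𝟙 X : X ⟶ X).op = 𝟙 _ := (B k).map_id (op X)
  have key : ∀ (s : Unit) (g : (B k).obj (op X) ⟶ M),
      (NatTrans.app (𝟙 (deltaHB k)) (op (deltaHFamily.obj X s)) ≫
        (B k).map (deltaHFamily.unit X s).op) ≫ g = g := by
    intro s g
    change (𝟙 _ ≫ (B k).map (𝟙 X : X ⟶ X).op) ≫ g = g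
    rw [h, Category.id_comp]
    exact Category.id_comp g
  exact ⟨f (), fun s => key s _, fun g hg => (key () g).symm.trans (hg ())⟩

end InvolutiveNonCommSets

open CategoryTheory InvolutiveNonCommSets in
theorem theorem9p2 {k : Type u} [CommRing k] (F : IFas ⥤ ModuleCat.{u} k) :
    Nonempty (dihedralHomology (duality ⋙ inclusion ⋙ F) ≅ FunctorHomology.Tor (B k) F) ∧
      Nonempty (FunctorHomology.Tor (B k) F ≅
        FunctorHomology.Tor (deltaHB k) (deltaHToIFas ⋙ F)) :=
  -- The two ways of bracketing `duality ⋙ inclusion ⋙ F` agree definitionally, so the general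
  -- result applies to `duality ⋙ inclusion` as it stands.
  ⟨(isInduced_constToB k).nonempty_tor_iso F,
    (isInduced_id_deltaHB k).nonempty_tor_iso F |>.map Iso.symm⟩
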